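/- Let $\mathcal D$ be a triangulated category whose Grothendieck group $K_0(\mathcal D)$ has finite rank, in the sense that $K_0(\mathcal D)$ modulo torsion is a finitely generated (free) abelian group, and fix a norm $\|\cdot\|$ on the real vector space $K_0(\mathcal D)\otimes_{\mathbb Z}\mathbb R$. A stability condition $\sigma=(Z,\mathcal P)$ on $\mathcal D$ consists of a group homomorphism $Z\colon K_0(\mathcal D)\to\mathbb C$ and full additive subcategories $\mathcal P(\phi)\subset\mathcal D$, $\phi\in\mathbb R$, closed under isomorphisms, such that: (1) for every nonzero $E\in\mathcal P(\phi)$ we have $Z([E])=m\,e^{\sqrt{-1}\pi\phi}$ for some $m\in\mathbb R_{>0}$; (2) $\mathcal P(\phi+1)=\mathcal P(\phi)[1]$ for all $\phi$; (3) $\operatorname{Hom}_{\mathcal D}(A_1,A_2)=0$ whenever $A_i\in\mathcal P(\phi_i)$ and $\phi_1>\phi_2$; (4) for every nonzero $E\in\mathcal D$ there are real numbers $\phi_1>\dots>\phi_n$ and exact triangles $E_{i-1}\to E_i\to A_i\to E_{i-1}[1]$ for $i=1,\dots,n$ with $E_0=0$, $E_n=E$ and $0\ne A_i\in\mathcal P(\phi_i)$.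 For an interval $I\subset\mathbb R$, let $\mathcal P(I)$ denote the extension closure of the subcategories $\mathcal P(\phi)$, $\phi\in I$. The stability condition $\sigma$ has the support property if there is $\varepsilon>0$ such that $\varepsilon\,\|[E]\|<|Z([E])|$ for every $\phi\in\mathbb R$ and every nonzero $E\in\mathcal P(\phi)$. Let $\sigma=(Z,\mathcal P)$ be a stability condition on $\mathcal D$ with the support property. Then the heart $\mathcal A=\mathcal P(0,1]$ is algebraic, that is, an abelian category in which every object has finite length and which has only finitely many isomorphism classes of simple objects, if and only if there is a real number $\delta>0$ such that $\mathcal P(0,\delta)=\{0\}$. -/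

import Mathlib

open CategoryTheory CategoryTheory.Limits CategoryTheory.Pretriangulated
open scoped TensorProduct

universe v u

namespace BridgelandStability

section Triangulated

variable (C : Type u) [Category.{v} C] [Preadditive C] [HasZeroObject C] [HasShift C ℤ]
  [∀ n : ℤ, (shiftFunctor C n).Additive] [Pretriangulated C]

/-- The relations `[Y] = [X] + [Z]`, one for each distinguished triangle `X ⟶ Y ⟶ Z ⟶ X⟦1⟧`. -/
def k0Relations : AddSubgroup (FreeAbelianGroup C) :=
  AddSubgroup.closure
    {r | ∃ T ∈ distTriang C, r = FreeAbelianGroup.of T.obj₂ -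
      (FreeAbelianGroup.of T.obj₁ + FreeAbelianGroup.of T.obj₃)}

/-- The Grothendieck group of a triangulated category. -/
abbrev K0 : Type u := FreeAbelianGroup C ⧸ k0Relations C

variable {C}

/-- The class `[X]` of an object in the Grothendieck group. -/
def K0.cls (X : C) : K0 C := QuotientAddGroup.mk (FreeAbelianGroup.of X)

theorem K0.cls_of_distTriang {T : Triangle C} (hT : T ∈ distTriang C) :
    K0.cls T.obj₂ = K0.cls T.obj₁ + K0.cls T.obj₃ := by
  unfold K0.cls
  rw [← QuotientAddGroup.mk_add, eq_comm, QuotientAddGroup.eq]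
  apply AddSubgroup.subset_closure
  exact ⟨T, hT, by abel⟩

/-- The extension closure of a full subcategory: the smallest full subcategory that contains it
and the zero objects, and that contains `Y` whenever it contains `X` and `Z` for some
distinguished triangle `X ⟶ Y ⟶ Z ⟶ X⟦1⟧`. It is closed under isomorphisms. -/
inductive ExtClosure (S : ObjectProperty C) : ObjectProperty C
  | zero (X : C) (hX : IsZero X) : ExtClosure S X
  | of (X : C) (hX : S X) : ExtClosure S X
  | ext (T : Triangle C) (hT : T ∈ distTriang C) (h₁ : ExtClosure S T.obj₁)
      (h₃ : ExtClosure S T.obj₃) : ExtClosure S T.obj₂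

/-- `E` has a Harder–Narasimhan filtration with respect to the subcategories `P φ`:
phases `φ 0 > φ 1 > ⋯ > φ (n-1)` and distinguished triangles
`F i ⟶ F (i+1) ⟶ A i ⟶ (F i)⟦1⟧` with `F 0 = 0`, `F n ≅ E` and `0 ≠ A i ∈ P (φ i)`. -/
def HasHNFiltration (P : ℝ → ObjectProperty C) (E : C) : Prop :=
  ∃ (n : ℕ) (φ : Fin n → ℝ) (F : Fin (n + 1) → C) (A : Fin n → C),
    StrictAnti φ ∧ IsZero (F 0) ∧ Nonempty (F (Fin.last n) ≅ E) ∧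
    ∀ i : Fin n, P (φ i) (A i) ∧ ¬ IsZero (A i) ∧
      ∃ (f : F i.castSucc ⟶ F i.succ) (g : F i.succ ⟶ A i)
        (h : A i ⟶ (F i.castSucc)⟦(1 : ℤ)⟧), Triangle.mk f g h ∈ distTriang C

variable (C)

/-- A stability condition `σ = (Z, P)` on a triangulated category. The full additive
subcategories `P φ` are taken to be closed under isomorphisms. -/
structure StabilityCondition where
  /-- The central charge. -/
  Z : K0 C →+ ℂ
  /-- The slicing. -/
  P : ℝ → ObjectProperty C
  of_iso : ∀ (φ : ℝ) {X Y : C}, (X ≅ Y) → P φ X → P φ Y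
  zero_mem : ∀ (φ : ℝ) (X : C), IsZero X → P φ X
  biprod_mem : ∀ (φ : ℝ) (X Y : C), P φ X → P φ Y → P φ (X ⊞ Y)
  charge : ∀ (φ : ℝ) (E : C), P φ E → ¬ IsZero E →
    ∃ m : ℝ, 0 < m ∧ Z (K0.cls E) = (m : ℂ) * Complex.exp (Complex.I * (Real.pi : ℂ) * (φ : ℂ))
  shift : ∀ (φ : ℝ) (E : C), P (φ + 1) (E⟦(1 : ℤ)⟧) ↔ P φ E
  hom_eq_zero : ∀ (φ₁ φ₂ : ℝ), φ₂ < φ₁ → ∀ (A₁ A₂ : C), P φ₁ A₁ → P φ₂ A₂ →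
    ∀ f : A₁ ⟶ A₂, f = 0
  exists_hn : ∀ E : C, ¬ IsZero E → HasHNFiltration P E

namespace StabilityCondition

variable {C} (σ : StabilityCondition C)

/-- `P(I)`, the extension closure of the subcategories `P φ` with `φ ∈ I`. -/
def interval (I : Set ℝ) : ObjectProperty C :=
  ExtClosure fun X => ∃ φ ∈ I, σ.P φ X

/-- The heart `P(0, 1]`, as a category: a full subcategory of `C`. -/
abbrev Heart : Type u := (σ.interval (Set.Ioc 0 1)).FullSubcategory

/-- The classes in `K0 C` of the semistable objects. -/
def semistableClasses : Set (K0 C) :=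
  {α | ∃ (φ : ℝ) (E : C), σ.P φ E ∧ ¬ IsZero E ∧ α = K0.cls E}

/-- The support property, with respect to a (semi)norm `N` on `K0 C ⊗ ℝ`. -/
def SupportProperty (N : Seminorm ℝ (ℝ ⊗[ℤ] K0 C)) : Prop :=
  ∃ ε : ℝ, 0 < ε ∧ ∀ α ∈ σ.semistableClasses, ε * N ((1 : ℝ) ⊗ₜ[ℤ] α) < ‖σ.Z α‖

end StabilityCondition

end Triangulated

/-- A category is algebraic if it is abelian, every object has finite length (that is, satisfies
both chain conditions on subobjects), and there are only finitely many isomorphism classes of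
simple objects. -/
structure IsAlgebraic (A : Type u) [Category.{v} A] [HasZeroMorphisms A] : Prop where
  abelian : Nonempty (Abelian A)
  noetherian : ∀ X : A, IsNoetherianObject X
  artinian : ∀ X : A, IsArtinianObject X
  finite_simples :
    {s : Quotient (isIsomorphicSetoid A) | ∃ S : A, Simple S ∧ Quotient.mk _ S = s}.Finite

end BridgelandStability

/-! For every `σ` the heart is that of a bounded t-structure: cutting Harder–Narasimhan filtrations
gives the truncations, and the heart is then abelian by the argument of Beilinson, Bernstein and
Deligne. The content is finite length and finiteness of the simples.

Gap implies algebraic. Semistable objects of the heart have phase in `[δ, 1]`. Turning `Z` clockwise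
by `πδ/2` puts their charges in a closed sector strictly inside the upper half plane, while the
support property and discreteness of `K0` modulo torsion bound `|Z|` below. So the rotated imaginary
part is additive and at least some `κ > 0` on every nonzero object of the heart (`exists_size`),
which bounds the length of chains of subobjects. Jordan–Hölder multiplicities are then additive on
the heart and extend to `K0 C` by an Euler characteristic (`exists_additive_extension`). Hence
classes of nonisomorphic simples are independent modulo torsion, and finite rank leaves finitely
many (`IsSize.finite_simples`).

Algebraic implies gap. The finitely many simples have charges in the upper half plane or on the
negative real axis, so a rotation by a small angle `πt` keeps all their imaginary parts nonnegative.
By finite length the same holds on the whole heart (`nonneg_of_nonneg_on_simples`), which excludes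
nonzero semistable objects of phase in `(0, t)`. -/

namespace BridgelandStability

open CategoryTheory.Triangulated
open scoped ZeroObject

/-! ### Extension closures, Harder–Narasimhan filtrations and the t-structure. -/

section Slicing

variable {C : Type u} [Category.{v} C] [Preadditive C] [HasZeroObject C] [HasShift C ℤ]
  [∀ n : ℤ, (shiftFunctor C n).Additive] [Pretriangulated C]

namespace ExtClosure

variable {S S' : ObjectProperty C}

theorem ext_mk {X Y Z : C} {f : X ⟶ Y} {g : Y ⟶ Z} {h : Z ⟶ X⟦(1 : ℤ)⟧}
    (hT : Triangle.mk f g h ∈ distTriang C) (hX : ExtClosure S X) (hZ : ExtClosure S Z) :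
    ExtClosure S Y :=
  ExtClosure.ext (Triangle.mk f g h) hT hX hZ

theorem of_iso {X Y : C} (e : X ≅ Y) (hX : ExtClosure S X) : ExtClosure S Y := by
  have hT : Triangle.mk e.hom (0 : Y ⟶ (0 : C)) 0 ∈ distTriang C :=
    (Triangle.distinguished_iff_of_isZero₃ _ (isZero_zero C)).2 (inferInstanceAs (IsIso e.hom))
  exact ext_mk hT hX (ExtClosure.zero _ (isZero_zero C))

instance : (ExtClosure S).IsClosedUnderIsomorphisms where
  of_iso e h := of_iso e h

theorem mono (h : S ≤ S') : ExtClosure S ≤ ExtClosure S' := by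
  intro X hX
  induction hX with
  | zero X hX => exact .zero X hX
  | of X hX => exact .of X (h X hX)
  | ext T hT _ _ h₁ h₃ => exact .ext T hT h₁ h₃

theorem shift (n : ℤ) (h : ∀ X, S X → S' (X⟦n⟧)) {X : C} (hX : ExtClosure S X) :
    ExtClosure S' (X⟦n⟧) := by
  induction hX with
  | zero X hX => exact .zero _ ((shiftFunctor C n).map_isZero hX)
  | of X hX => exact .of _ (h X hX)
  | ext T hT _ _ h₁ h₃ => exact .ext _ (Triangle.shift_distinguished T hT n) h₁ h₃

/-- Dévissage in both variables: a map that vanishes on one end of a triangle factors through the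
other end, because `Hom` is exact on triangles. -/
theorem hom_eq_zero (h : ∀ X Y, S X → S' Y → ∀ f : X ⟶ Y, f = 0) {X Y : C}
    (hX : ExtClosure S X) (hY : ExtClosure S' Y) (f : X ⟶ Y) : f = 0 := by
  induction hX with
  | zero X hX => exact hX.eq_of_src _ _
  | of X hX =>
    induction hY with
    | zero Y hY => exact hY.eq_of_tgt _ _
    | of Y hY => exact h X Y hX hY f
    | ext T hT _ _ h₁ h₃ =>
      obtain ⟨g, rfl⟩ := Triangle.coyoneda_exact₂ T hT f (h₃ _)
      rw [h₁ g, zero_comp]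
  | ext T hT _ _ h₁ h₃ =>
    obtain ⟨g, rfl⟩ := Triangle.yoneda_exact₂ T hT f (h₁ _)
    rw [h₃ g, comp_zero]

end ExtClosure

namespace StabilityCondition

variable (σ : StabilityCondition C)

theorem P_shift (n : ℤ) {φ : ℝ} {E : C} (h : σ.P φ E) : σ.P (φ + n) (E⟦n⟧) := by
  induction n using Int.induction_on with
  | zero =>
    simpa using σ.of_iso _ ((shiftFunctorZero C ℤ).symm.app E) h
  | succ n ih =>
    have := (σ.shift _ _).2 ih
    rw [add_assoc] at this
    push_cast
    exact σ.of_iso _ ((shiftFunctorAdd' C (n : ℤ) 1 (n + 1) rfl).symm.app E) (by simpa using this)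
  | pred n ih =>
    rw [← σ.shift]
    have e : E⟦(-n - 1 : ℤ)⟧⟦(1 : ℤ)⟧ ≅ E⟦(-n : ℤ)⟧ :=
      (shiftFunctorAdd' C (-n - 1 : ℤ) 1 (-n) (by lia)).symm.app E
    have h' : φ + ((-n - 1 : ℤ) : ℝ) + 1 = φ + ((-n : ℤ) : ℝ) := by push_cast; ring
    rw [h']
    exact σ.of_iso _ e.symm ih

theorem interval_mono {I J : Set ℝ} (h : I ⊆ J) : σ.interval I ≤ σ.interval J :=
  ExtClosure.mono fun _ ⟨φ, hφ, hX⟩ => ⟨φ, h hφ, hX⟩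

theorem interval_of_P {I : Set ℝ} {φ : ℝ} {X : C} (hX : σ.P φ X) (hφ : φ ∈ I) :
    σ.interval I X :=
  .of X ⟨φ, hφ, hX⟩

theorem interval_ext {I : Set ℝ} {X Y Z : C} {f : X ⟶ Y} {g : Y ⟶ Z} {h : Z ⟶ X⟦(1 : ℤ)⟧}
    (hT : Triangle.mk f g h ∈ distTriang C) (hX : σ.interval I X) (hZ : σ.interval I Z) :
    σ.interval I Y :=
  ExtClosure.ext_mk hT hX hZ

theorem interval_shift {I J : Set ℝ} (n : ℤ) (h : ∀ φ ∈ I, φ + n ∈ J) {X : C}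
    (hX : σ.interval I X) : σ.interval J (X⟦n⟧) :=
  ExtClosure.shift n (fun _ ⟨φ, hφ, hX⟩ => ⟨φ + n, h φ hφ, σ.P_shift n hX⟩) hX

theorem interval_hom_eq_zero {I J : Set ℝ} (h : ∀ φ ∈ I, ∀ ψ ∈ J, ψ < φ) {X Y : C}
    (hX : σ.interval I X) (hY : σ.interval J Y) (f : X ⟶ Y) : f = 0 :=
  ExtClosure.hom_eq_zero
    (fun A B ⟨φ, hφ, hA⟩ ⟨ψ, hψ, hB⟩ f => σ.hom_eq_zero φ ψ (h φ hφ ψ hψ) A B hA hB f) hX hY f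

instance (I : Set ℝ) : (σ.interval I).IsClosedUnderIsomorphisms :=
  inferInstanceAs (ExtClosure _).IsClosedUnderIsomorphisms

/-- `σ.HN J b E`: the object `E` has a filtration by semistable objects with strictly decreasing
phases, all of them in `J` and at least `b`. -/
inductive HN (J : Set ℝ) : ℝ → C → Prop
  | zero (b : ℝ) (X : C) (hX : IsZero X) : HN J b X
  | step (T : Triangle C) (hT : T ∈ distTriang C) (b φ : ℝ) (hφ : φ ∈ J) (hb : φ < b)
      (h₁ : HN J b T.obj₁) (h₃ : σ.P φ T.obj₃) : HN J φ T.obj₂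

variable {σ}

theorem HN.of_iso {J : Set ℝ} {b : ℝ} {X Y : C} (e : X ≅ Y) (h : σ.HN J b X) : σ.HN J b Y := by
  cases h with
  | zero _ _ hX => exact .zero _ _ (hX.of_iso e.symm)
  | step T hT b φ hφ hb h₁ h₃ =>
    have hT' : Triangle.mk (T.mor₁ ≫ e.hom) (e.inv ≫ T.mor₂) T.mor₃ ∈ distTriang C :=
      isomorphic_distinguished _ hT _
        (Triangle.isoMk _ _ (Iso.refl _) e.symm (Iso.refl _)
          (((Category.assoc T.mor₁ e.hom e.inv).trans
            ((congrArg (T.mor₁ ≫ ·) e.hom_inv_id).trans (Category.comp_id T.mor₁))).trans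
              (Category.id_comp T.mor₁).symm)
          (Category.comp_id (e.inv ≫ T.mor₂))
          ((congrArg (T.mor₃ ≫ ·) ((shiftFunctor C (1 : ℤ)).map_id T.obj₁)).trans
            ((Category.comp_id T.mor₃).trans (Category.id_comp T.mor₃).symm)))
    exact HN.step _ hT' b _ hφ hb h₁ h₃

theorem HN.interval {J : Set ℝ} {b : ℝ} {X : C} (h : σ.HN J b X) : σ.interval (J ∩ Set.Ici b) X := by
  induction h with
  | zero _ _ hX => exact .zero _ hX
  | step T hT b φ hφ hb h₁ h₃ ih =>
    refine σ.interval_ext hT (σ.interval_mono ?_ _ ih) (σ.interval_of_P h₃ ⟨hφ, Set.self_mem_Ici⟩)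
    exact fun x hx => ⟨hx.1, hb.le.trans hx.2⟩

theorem HN.inter_Ici {J : Set ℝ} {b : ℝ} {X : C} (h : σ.HN J b X) :
    σ.HN (J ∩ Set.Ici b) b X := by
  -- The bound `c` must vary: each step has a smaller bound than the filtration it extends.
  suffices ∀ c ≤ b, σ.HN (J ∩ Set.Ici c) b X from this b le_rfl
  induction h with
  | zero _ _ hX => exact fun c _ => .zero _ _ hX
  | step T hT b φ hφ hb h₁ h₃ ih =>
    exact fun c hc => .step T hT b φ ⟨hφ, hc⟩ hb (ih c (hc.trans hb.le)) h₃

theorem HN.mono {J J' : Set ℝ} {b : ℝ} {X : C} (h : σ.HN J b X) (hJ : J ⊆ J') :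
    σ.HN J' b X := by
  induction h with
  | zero _ _ hX => exact .zero _ _ hX
  | step T hT b φ hφ hb h₁ h₃ ih => exact .step T hT b φ (hJ hφ) hb ih h₃

variable (σ)

theorem exists_HN (E : C) : ∃ b, σ.HN Set.univ b E := by
  by_cases hE : IsZero E
  · exact ⟨0, .zero _ _ hE⟩
  obtain ⟨n, φ, F, A, hφ, h0, ⟨e⟩, hF⟩ := σ.exists_hn E hE
  -- The index `b` is kept strictly above every phase still to come, as `HN.step` requires.
  have key : ∀ i : Fin (n + 1), ∃ b, (∀ j : Fin n, i ≤ j.castSucc → φ j < b) ∧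
      σ.HN Set.univ b (F i) := by
    intro i
    induction i using Fin.induction with
    | zero =>
      obtain ⟨b, hb⟩ := (Set.finite_range φ).bddAbove
      exact ⟨b + 1, fun j _ => (hb ⟨j, rfl⟩).trans_lt (lt_add_one b), .zero _ _ h0⟩
    | succ i ih =>
      obtain ⟨b, hb, h⟩ := ih
      obtain ⟨hP, -, f, g, h', hT⟩ := hF i
      refine ⟨φ i, fun j hj => hφ ?_, .step _ hT b _ (Set.mem_univ _) (hb i le_rfl) h hP⟩
      exact Fin.succ_le_castSucc_iff.1 hj
  obtain ⟨b, -, h⟩ := key (Fin.last n)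
  exact ⟨b, h.of_iso e⟩

variable {σ}

/-- Factors are peeled off from the lowest phase. While the phase is at most `c`, the octahedral
axiom attaches the factor to the low part `Y`; once it exceeds `c`, so do all the others and the
whole object is the high part. -/
theorem HN.cut [IsTriangulated C] {J : Set ℝ} {b : ℝ} {E : C} (h : σ.HN J b E) (c : ℝ) :
    ∃ (X Y : C) (b' : ℝ) (_ : σ.HN (J ∩ Set.Ioi c) b' X) (_ : σ.interval (J ∩ Set.Iic c) Y)
      (f : X ⟶ E) (g : E ⟶ Y) (w : Y ⟶ X⟦(1 : ℤ)⟧), Triangle.mk f g w ∈ distTriang C := by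
  have big : ∀ {b : ℝ} {E : C}, c < b → σ.HN J b E →
    ∃ (X Y : C) (b' : ℝ) (_ : σ.HN (J ∩ Set.Ioi c) b' X) (_ : σ.interval (J ∩ Set.Iic c) Y)
      (f : X ⟶ E) (g : E ⟶ Y) (w : Y ⟶ X⟦(1 : ℤ)⟧), Triangle.mk f g w ∈ distTriang C := by
    intro b E hb h
    have hE : σ.HN (J ∩ Set.Ioi c) b E :=
      h.inter_Ici.mono fun x hx => ⟨hx.1, hb.trans_le hx.2⟩
    exact ⟨E, 0, b, hE,
      .zero _ (isZero_zero C), 𝟙 E, 0, 0, contractible_distinguished E⟩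
  induction h with
  | zero b E hE => exact big (lt_add_one c) (.zero _ _ hE)
  | step T hT b φ hφ hb h₁ h₃ ih =>
    by_cases hc : c < φ
    · exact big hc (.step T hT b φ hφ hb h₁ h₃)
    · obtain ⟨X, Y, b', hX, hY, f, g, w, hT'⟩ := ih
      obtain ⟨Z, g', w', hZ⟩ := distinguished_cocone_triangle (f ≫ T.mor₁)
      have H := someOctahedron rfl hT' hT hZ
      exact ⟨X, Z, b', hX, σ.interval_ext H.mem hY
        (σ.interval_of_P h₃ ⟨hφ, not_lt.1 hc⟩), _, _, _, hZ⟩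

variable (σ)

/-- The bounded t-structure with `D^{≤ 0} = P(0, ∞)` and `D^{≥ 0} = P(-∞, 1]`. -/
def tStructure [IsTriangulated C] : TStructure C where
  le n := σ.interval (Set.Ioi (-n))
  ge n := σ.interval (Set.Iic (1 - n))
  le_shift n a n' h X hX := σ.interval_shift a (fun φ hφ => by
    subst h; simp only [Set.mem_Ioi] at *; push_cast at hφ; linarith) hX
  ge_shift n a n' h X hX := σ.interval_shift a (fun φ hφ => by
    subst h; simp only [Set.mem_Iic] at *; push_cast at hφ; linarith) hX
  zero' X Y f hX hY := σ.interval_hom_eq_zero (fun φ hφ ψ hψ => by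
    simp at hφ hψ; linarith) hX hY f
  le_zero_le := σ.interval_mono fun φ hφ => by simp at *; linarith
  ge_one_le := σ.interval_mono fun φ hφ => by simp at *; linarith
  exists_triangle_zero_one A := by
    obtain ⟨b, hb⟩ := σ.exists_HN A
    obtain ⟨X, Y, b', hX, hY, f, g, w, hT⟩ := hb.cut 0
    exact ⟨X, Y, σ.interval_mono (by intro x; simp; tauto) _ hX.interval,
      σ.interval_mono (by intro x; simp) _ hY, f, g, w, hT⟩

theorem tStructure_le [IsTriangulated C] (n : ℤ) :
    σ.tStructure.le n = σ.interval (Set.Ioi (-n)) := rfl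

theorem tStructure_ge [IsTriangulated C] (n : ℤ) :
    σ.tStructure.ge n = σ.interval (Set.Iic (1 - n)) := rfl

/-- Cutting at `0` leaves no low part `Y`: the map to it vanishes, so its identity factors through a
shift of `X`, which has larger phases. Dually, cutting at `1` leaves no high part. -/
theorem tStructure_heart [IsTriangulated C] :
    σ.tStructure.heart = σ.interval (Set.Ioc 0 1) := by
  ext E
  constructor
  · rintro ⟨hle, hge⟩
    simp only [tStructure_le, tStructure_ge, Int.cast_zero, neg_zero, sub_zero] at hle hge
    obtain ⟨b, hb⟩ := σ.exists_HN E
    obtain ⟨X, Y, b', hX, hY, f, g, w, hT⟩ := hb.cut 0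
    have hg : g = 0 := σ.interval_hom_eq_zero
      (fun φ hφ ψ hψ => lt_of_le_of_lt hψ.2 hφ) hle hY g
    have hYzero : IsZero Y := by
      rw [IsZero.iff_id_eq_zero]
      obtain ⟨k, hk⟩ := Triangle.yoneda_exact₃ _ hT (𝟙 Y) (by rw [hg]; exact zero_comp)
      have hX1 : σ.interval (Set.Ioi 0) (X⟦(1 : ℤ)⟧) :=
        σ.interval_shift 1 (fun φ hφ => by
          have := hφ.1.2; simp at *; linarith) hX.interval
      rw [hk, σ.interval_hom_eq_zero (fun φ hφ ψ hψ => lt_of_le_of_lt hψ.2 hφ) hX1 hY k]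
      exact comp_zero
    have : IsIso f := (Triangle.isZero₃_iff_isIso₁ _ hT).1 hYzero
    obtain ⟨X', Y', b'', hX', hY', f', g', w', hT'⟩ := (hX.of_iso (asIso f)).cut 1
    have hf' : f' = 0 := σ.interval_hom_eq_zero
      (fun φ hφ ψ hψ => lt_of_le_of_lt hψ hφ.1.2) hX'.interval hge f'
    have hX'zero : IsZero (X'⟦(1 : ℤ)⟧) := by
      rw [IsZero.iff_id_eq_zero]
      obtain ⟨k, hk⟩ := Triangle.coyoneda_exact₁ _ hT' (𝟙 (X'⟦(1 : ℤ)⟧)) (by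
        rw [hf']; exact (Category.id_comp _).trans ((shiftFunctor C (1 : ℤ)).map_zero X' E))
      have hX1 : σ.interval (Set.Ioi 1) (X'⟦(1 : ℤ)⟧) :=
        σ.interval_shift 1 (fun φ hφ => by
          have := hφ.1.2; simp at *; linarith) hX'.interval
      rw [hk, σ.interval_hom_eq_zero (fun φ hφ ψ hψ => lt_of_le_of_lt hψ.2 hφ) hX1 hY' k]
      exact zero_comp
    have hX'' : IsZero X' := by
      rw [IsZero.iff_id_eq_zero]
      apply (shiftFunctor C (1 : ℤ)).map_injective
      exact hX'zero.eq_of_src _ _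
    have : IsIso g' := (Triangle.isZero₁_iff_isIso₂ _ hT').1 hX''
    exact ExtClosure.of_iso (asIso g').symm
      (σ.interval_mono (J := Set.Ioc 0 1) (fun φ hφ => ⟨hφ.1.2, hφ.2⟩) _ hY')
  · intro h
    exact ⟨σ.interval_mono (fun φ hφ => by simpa using hφ.1) _ h,
      σ.interval_mono (fun φ hφ => by simpa using hφ.2) _ h⟩

theorem tStructure_bounded [IsTriangulated C] (E : C) :
    ∃ a b : ℤ, σ.tStructure.IsGE E a ∧ σ.tStructure.IsLE E b := by
  have h : ∃ a b : ℝ, σ.interval (Set.Icc a b) E := by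
    obtain ⟨c, hc⟩ := σ.exists_HN E
    induction hc with
    | zero _ _ hX => exact ⟨0, 0, ExtClosure.zero _ hX⟩
    | step T hT b φ hφ hb h₁ h₃ ih =>
      obtain ⟨x, y, hxy⟩ := ih
      refine ⟨min x φ, max y φ, σ.interval_ext hT (σ.interval_mono ?_ _ hxy) (σ.interval_of_P h₃ ?_)⟩
      · exact Set.Icc_subset_Icc (min_le_left _ _) (le_max_left _ _)
      · exact ⟨min_le_right _ _, le_max_right _ _⟩
  obtain ⟨x, y, h⟩ := h
  refine ⟨1 - ⌈y⌉, 1 - ⌊x⌋, ⟨σ.interval_mono (fun φ hφ => ?_) _ h⟩,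
    ⟨σ.interval_mono (fun φ hφ => ?_) _ h⟩⟩
  · have := Int.le_ceil y
    have := hφ.2
    simp only [Set.mem_Iic, Int.cast_sub, Int.cast_one]
    linarith
  · have := Int.floor_le x
    have := hφ.1
    simp only [Set.mem_Ioi, Int.cast_sub, Int.cast_one]
    linarith

end StabilityCondition

end Slicing

end BridgelandStability
-- The heart as an abelian category and its short exact sequences.
namespace BridgelandStability

open CategoryTheory.Triangulated
open scoped ZeroObject

namespace StabilityCondition

variable {C : Type u} [Category.{v} C] [Preadditive C] [HasZeroObject C] [HasShift C ℤ]
  [∀ n : ℤ, (shiftFunctor C n).Additive] [Pretriangulated C]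
  (σ : StabilityCondition C)

/-- The inclusion of the heart. -/
abbrev heartι : σ.Heart ⥤ C := (σ.interval (Set.Ioc 0 1)).ι

instance : (σ.interval (Set.Ioc 0 1)).ContainsZero where
  exists_zero := ⟨0, isZero_zero C, ExtClosure.zero _ (isZero_zero C)⟩

instance : (σ.interval (Set.Ioc 0 1)).IsClosedUnderBinaryProducts where
  limitsOfShape_le := by
    rintro X ⟨p⟩
    refine ExtClosure.of_iso ?_ (ExtClosure.ext _ (binaryProductTriangle_distinguished _ _)
      (p.prop_diag_obj (.mk .left)) (p.prop_diag_obj (.mk .right)))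
    exact IsLimit.conePointUniqueUpToIso (prodIsProd _ _)
      ((IsLimit.postcomposeHomEquiv (diagramIsoPair p.diag) _).2 p.isLimit)

instance : (σ.interval (Set.Ioc 0 1)).IsClosedUnderFiniteProducts := .mk'

variable {σ} in
theorem heart_isZero_iff {X : σ.Heart} : IsZero X ↔ IsZero X.obj := by
  rw [IsZero.iff_id_eq_zero, IsZero.iff_id_eq_zero]
  exact ⟨fun h => congrArg (·.hom) h, fun h => ObjectProperty.hom_ext _ h⟩

section

variable [IsTriangulated C]

instance (X : σ.Heart) : σ.tStructure.IsLE X.obj 0 :=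
  ⟨(σ.tStructure_heart.symm ▸ X.property : σ.tStructure.heart X.obj).1⟩

instance (X : σ.Heart) : σ.tStructure.IsGE X.obj 0 :=
  ⟨(σ.tStructure_heart.symm ▸ X.property : σ.tStructure.heart X.obj).2⟩

theorem interval_Ioc_of_isLE_of_isGE (X : C) [h₁ : σ.tStructure.IsLE X 0]
    [h₂ : σ.tStructure.IsGE X 0] : σ.interval (Set.Ioc 0 1) X := by
  rw [← tStructure_heart]
  exact ⟨h₁.le, h₂.ge⟩

theorem heart_hom_shift_eq_zero ⦃X Y : σ.Heart⦄ ⦃n : ℤ⦄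
    (f : σ.heartι.obj X ⟶ (σ.heartι.obj Y)⟦n⟧) (hn : n < 0) : f = 0 := by
  have : σ.tStructure.IsGE (Y.obj⟦n⟧) (-n) := σ.tStructure.isGE_shift Y.obj 0 n (-n)
  exact σ.tStructure.zero_of_isLE_of_isGE f 0 (-n) (by lia)
    (inferInstanceAs (σ.tStructure.IsLE X.obj 0)) this

/-- The cone of a map in the heart lives in degrees `-1` and `0`. Its truncation triangle exhibits
it as an extension of an object of the heart (the cokernel) by the shift of another (the kernel). -/
theorem heart_admissibleMorphism :
    AbelianSubcategory.admissibleMorphism σ.heartι = ⊤ := by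
  ext X₁ X₂ f₁
  simp only [MorphismProperty.top_apply, iff_true]
  intro X₃ f₂ f₃ hT
  have hLE : σ.tStructure.IsLE X₃ 0 := σ.tStructure.isLE₂ _ (rot_of_distTriang _ hT) 0
    (inferInstanceAs (σ.tStructure.IsLE X₂.obj 0))
    (by
      have := σ.tStructure.isLE_shift X₁.obj 0 1 (-1)
      exact σ.tStructure.isLE_of_le (X₁.obj⟦(1 : ℤ)⟧) (-1) 0)
  have hGE : σ.tStructure.IsGE X₃ (-1) := σ.tStructure.isGE₂ _ (rot_of_distTriang _ hT) (-1)
    (σ.tStructure.isGE_of_ge X₂.obj (-1) 0)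
    (σ.tStructure.isGE_shift X₁.obj 0 1 (-1))
  obtain ⟨K, Q, hK, hQ, α, β, γ, hT'⟩ := σ.tStructure.exists_triangle X₃ (-1) 0 (by lia)
  have hK' : σ.tStructure.IsLE K (-1) := ⟨hK⟩
  have hQ' : σ.tStructure.IsGE Q 0 := ⟨hQ⟩
  have hQ1 : σ.tStructure.IsLE Q 0 := σ.tStructure.isLE₂ _ (rot_of_distTriang _ hT') 0 hLE
    (by
      have := σ.tStructure.isLE_shift K (-1) 1 (-2)
      exact σ.tStructure.isLE_of_le (K⟦(1 : ℤ)⟧) (-2) 0)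
  have hK1 : σ.tStructure.IsGE K (-1) := σ.tStructure.isGE₂ _ (inv_rot_of_distTriang _ hT') (-1)
    (by
      have := σ.tStructure.isGE_shift Q 0 (-1) 1
      exact σ.tStructure.isGE_of_ge (Q⟦(-1 : ℤ)⟧) (-1) 1) hGE
  have := σ.tStructure.isLE_shift K (-1) (-1) 0
  have := σ.tStructure.isGE_shift K (-1) (-1) 0
  let e : (K⟦(-1 : ℤ)⟧)⟦(1 : ℤ)⟧ ≅ K := (shiftEquiv C (1 : ℤ)).counitIso.app K
  refine ⟨⟨K⟦(-1 : ℤ)⟧, σ.interval_Ioc_of_isLE_of_isGE _⟩,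
    ⟨Q, σ.interval_Ioc_of_isLE_of_isGE _⟩, e.hom ≫ α, β, γ ≫ e.inv⟦(1 : ℤ)⟧', ?_⟩
  refine isomorphic_distinguished _ hT' _ (Triangle.isoMk _ _ e (Iso.refl _) (Iso.refl _) ?_ ?_ ?_)
  · exact Category.comp_id (e.hom ≫ α)
  · exact (Category.comp_id β).trans (Category.id_comp β).symm
  · refine (Category.assoc γ (e.inv⟦(1 : ℤ)⟧') (e.hom⟦(1 : ℤ)⟧')).trans (Eq.trans ?_
      (Category.id_comp γ).symm)
    rw [← Functor.map_comp, e.inv_hom_id, CategoryTheory.Functor.map_id]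
    exact Category.comp_id γ

noncomputable instance : Abelian σ.Heart :=
  AbelianSubcategory.abelian σ.heartι σ.heart_hom_shift_eq_zero σ.heart_admissibleMorphism

end

variable {σ}

/-- Two composable morphisms in the heart that belong to a distinguished triangle. -/
def SES {X Y Z : σ.Heart} (i : X ⟶ Y) (p : Y ⟶ Z) : Prop :=
  ∃ δ : Z.obj ⟶ X.obj⟦(1 : ℤ)⟧, Triangle.mk i.hom p.hom δ ∈ distTriang C

namespace SES

theorem cls {X Y Z : σ.Heart} {i : X ⟶ Y} {p : Y ⟶ Z} (h : SES i p) :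
    K0.cls Y.obj = K0.cls X.obj + K0.cls Z.obj :=
  K0.cls_of_distTriang h.choose_spec

variable {X Y Z : σ.Heart} {i : X ⟶ Y} {p : Y ⟶ Z}

theorem zero (h : SES i p) : i ≫ p = 0 :=
  ObjectProperty.hom_ext _ (comp_distTriang_mor_zero₁₂ _ h.choose_spec)

theorem exists_lift (h : SES i p) {B : σ.Heart} (x : B ⟶ Y) (hx : x ≫ p = 0) :
    ∃ k : B ⟶ X, k ≫ i = x := by
  obtain ⟨k, hk⟩ := Triangle.coyoneda_exact₂ _ h.choose_spec x.hom (congrArg (·.hom) hx)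
  exact ⟨ObjectProperty.homMk k, ObjectProperty.hom_ext _ hk.symm⟩

theorem exists_desc (h : SES i p) {B : σ.Heart} (x : Y ⟶ B) (hx : i ≫ x = 0) :
    ∃ k : Z ⟶ B, p ≫ k = x := by
  obtain ⟨k, hk⟩ := Triangle.yoneda_exact₂ _ h.choose_spec x.hom (congrArg (·.hom) hx)
  exact ⟨ObjectProperty.homMk k, ObjectProperty.hom_ext _ hk.symm⟩

theorem isZero_right_iff (h : SES i p) : IsZero Z ↔ IsIso i := by
  obtain ⟨δ, hT⟩ := h
  rw [heart_isZero_iff, ← ObjectProperty.isIso_hom_iff]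
  exact Triangle.isZero₃_iff_isIso₁ _ hT

theorem isZero_left_iff (h : SES i p) : IsZero X ↔ IsIso p := by
  obtain ⟨δ, hT⟩ := h
  rw [heart_isZero_iff, ← ObjectProperty.isIso_hom_iff]
  exact Triangle.isZero₁_iff_isIso₂ _ hT

theorem comp_iso_right (h : SES i p) {W : σ.Heart} (e : Z ≅ W) : SES i (p ≫ e.hom) := by
  obtain ⟨δ, hT⟩ := h
  let e' : Z.obj ≅ W.obj := σ.heartι.mapIso e
  refine ⟨e'.inv ≫ δ, isomorphic_distinguished _ hT _
    (Triangle.isoMk _ _ (Iso.refl _) (Iso.refl _) e'.symm ?_ ?_ ?_)⟩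
  · exact (Category.comp_id i.hom).trans (Category.id_comp i.hom).symm
  · exact ((Category.assoc p.hom e'.hom e'.inv).trans ((congrArg (p.hom ≫ ·) e'.hom_inv_id).trans
      (Category.comp_id p.hom))).trans (Category.id_comp p.hom).symm
  · exact (congrArg ((e'.inv ≫ δ) ≫ ·) ((shiftFunctor C (1 : ℤ)).map_id X.obj)).trans
      (Category.comp_id _)

variable [IsTriangulated C]

/-- A map killed by `i` factors through `Z⟦-1⟧`, which receives only zero maps from the heart. -/
theorem mono (h : SES i p) : Mono i := by
  obtain ⟨δ, hT⟩ := h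
  rw [Preadditive.mono_iff_cancel_zero]
  intro B k hk
  obtain ⟨l, hl⟩ := Triangle.coyoneda_exact₂ _ (inv_rot_of_distTriang _ hT) k.hom
    (congrArg (·.hom) hk)
  have hl0 : l = 0 := σ.heart_hom_shift_eq_zero (X := B) (Y := Z) (n := -1) l (by lia)
  refine ObjectProperty.hom_ext _ (hl.trans ?_)
  rw [hl0]
  exact zero_comp

theorem epi (h : SES i p) : Epi p := by
  obtain ⟨δ, hT⟩ := h
  rw [Preadditive.epi_iff_cancel_zero]
  intro B k hk
  obtain ⟨l, hl⟩ := Triangle.yoneda_exact₃ _ hT k.hom (congrArg (·.hom) hk)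
  have hl0 : l = 0 := AbelianSubcategory.eq_zero_of_hom_shift_pos (ι := σ.heartι)
    σ.heart_hom_shift_eq_zero (X := X) (Y := B) (n := 1) l (by lia)
  refine ObjectProperty.hom_ext _ (hl.trans ?_)
  rw [hl0]
  exact comp_zero

theorem of_epi (p : Y ⟶ Z) [Epi p] : ∃ (X : σ.Heart) (i : X ⟶ Y), SES i p := by
  obtain ⟨X, i, δ, h⟩ := AbelianSubcategory.exists_distinguished_triangle_of_epi
    (ι := σ.heartι) σ.heart_hom_shift_eq_zero σ.heart_admissibleMorphism p
  exact ⟨X, i, δ, h⟩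

/-- The term `K` of the admissible triangle is the kernel of `i`, hence zero, so the cone of `i` is
already in the heart. -/
theorem of_mono (i : X ⟶ Y) [Mono i] : ∃ (Z : σ.Heart) (p : Y ⟶ Z), SES i p := by
  obtain ⟨X₃, f₂, f₃, hT⟩ := distinguished_cocone_triangle (σ.heartι.map i)
  have : AbelianSubcategory.admissibleMorphism σ.heartι i := by
    rw [σ.heart_admissibleMorphism]; trivial
  obtain ⟨K, Q, α, β, γ, hT'⟩ := this f₂ f₃ hT
  have hm := AbelianSubcategory.mono_ιK σ.heart_hom_shift_eq_zero hT hT'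
  have hK0 : AbelianSubcategory.ιK f₃ α = 0 := by
    rw [← cancel_mono i, zero_comp]
    exact AbelianSubcategory.ιK_mor₁ hT α
  have hK : IsZero K.obj := by
    rw [← heart_isZero_iff, IsZero.iff_id_eq_zero, ← cancel_mono (AbelianSubcategory.ιK f₃ α), hK0]
    simp
  have hβ : IsIso β := (Triangle.isZero₁_iff_isIso₂ _ hT').1 ((shiftFunctor C (1 : ℤ)).map_isZero hK)
  refine ⟨Q, ObjectProperty.homMk (f₂ ≫ β), inv β ≫ f₃, isomorphic_distinguished _ hT _
    (Triangle.isoMk _ _ (Iso.refl _) (Iso.refl _) (asIso β).symm ?_ ?_ ?_)⟩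
  · exact (Category.comp_id i.hom).trans (Category.id_comp i.hom).symm
  · exact ((Category.assoc f₂ β (inv β)).trans ((congrArg (f₂ ≫ ·) (IsIso.hom_inv_id β)).trans
      (Category.comp_id f₂))).trans (Category.id_comp f₂).symm
  · exact (congrArg ((inv β ≫ f₃) ≫ ·) ((shiftFunctor C (1 : ℤ)).map_id X.obj)).trans
      (Category.comp_id _)

/-- The quotient is determined up to isomorphism by its universal property. -/
theorem iso_right (h : SES i p) {W : σ.Heart} {q : Y ⟶ W} (hq : i ≫ q = 0)
    [Epi q] (hd : ∀ {B : σ.Heart} (x : Y ⟶ B), i ≫ x = 0 → ∃ k : W ⟶ B, q ≫ k = x) :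
    ∃ e : Z ≅ W, p ≫ e.hom = q := by
  have := h.epi
  obtain ⟨a, ha⟩ := h.exists_desc q hq
  obtain ⟨b, hb⟩ := hd p h.zero
  exact ⟨⟨a, b, by rw [← cancel_epi p, reassoc_of% ha, hb, Category.comp_id],
    by rw [← cancel_epi q, reassoc_of% hb, ha, Category.comp_id]⟩, ha⟩

/-- For `X ⟶ Y ⟶ W`, both monomorphisms, the quotients `Y / X`, `W / X` and `W / Y` form a short
exact sequence. -/
theorem quotient {W X' Y' : σ.Heart} (h : SES i p) {j : Y ⟶ W} {q : W ⟶ Y'} (hj : SES j q)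
    {r : W ⟶ X'} (hr : SES (i ≫ j) r) :
    ∃ (a : Z ⟶ X') (b : X' ⟶ Y'), SES a b := by
  obtain ⟨δ, hT⟩ := h
  obtain ⟨δ', hT'⟩ := hj
  obtain ⟨δ'', hT''⟩ := hr
  -- The third isomorphism theorem is the octahedral axiom here.
  have H := someOctahedron (u₁₃ := (i ≫ j).hom) rfl hT hT' hT''
  exact ⟨ObjectProperty.homMk H.m₁, ObjectProperty.homMk H.m₃, _, H.mem⟩

end SES

end StabilityCondition

end BridgelandStability

/-! ### Extending additive functions from the heart of a bounded t-structure to `K0`. -/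

namespace CategoryTheory.Triangulated.TStructure

open scoped ZeroObject

variable {C : Type u} [Category.{v} C] [Preadditive C] [HasZeroObject C] [HasShift C ℤ]
  [∀ n : ℤ, (shiftFunctor C n).Additive] [Pretriangulated C]
  (t : TStructure C) {G : Type*} [AddCommGroup G]

theorem isLE₁ {X Y Z : C} {f : X ⟶ Y} {g : Y ⟶ Z} {h : Z ⟶ X⟦(1 : ℤ)⟧}
    (hT : Triangle.mk f g h ∈ distTriang C) (n : ℤ) (hY : t.IsLE Y n) (hZ : t.IsLE Z (n - 1)) :
    t.IsLE X n :=
  t.isLE₂ _ (inv_rot_of_distTriang _ hT) n (t.isLE_shift Z (n - 1) (-1) n) hY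

theorem isGE₁ {X Y Z : C} {f : X ⟶ Y} {g : Y ⟶ Z} {h : Z ⟶ X⟦(1 : ℤ)⟧}
    (hT : Triangle.mk f g h ∈ distTriang C) (n : ℤ) (hY : t.IsGE Y n) (hZ : t.IsGE Z (n - 1)) :
    t.IsGE X n :=
  t.isGE₂ _ (inv_rot_of_distTriang _ hT) n (t.isGE_shift Z (n - 1) (-1) n) hY

theorem isLE₃ {X Y Z : C} {f : X ⟶ Y} {g : Y ⟶ Z} {h : Z ⟶ X⟦(1 : ℤ)⟧}
    (hT : Triangle.mk f g h ∈ distTriang C) (n : ℤ) (hX : t.IsLE X (n + 1)) (hY : t.IsLE Y n) :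
    t.IsLE Z n :=
  t.isLE₂ _ (rot_of_distTriang _ hT) n hY (t.isLE_shift X (n + 1) 1 n)

theorem isGE₃ {X Y Z : C} {f : X ⟶ Y} {g : Y ⟶ Z} {h : Z ⟶ X⟦(1 : ℤ)⟧}
    (hT : Triangle.mk f g h ∈ distTriang C) (n : ℤ) (hX : t.IsGE X (n + 1)) (hY : t.IsGE Y n) :
    t.IsGE Z n :=
  t.isGE₂ _ (rot_of_distTriang _ hT) n hY (t.isGE_shift X (n + 1) 1 n)

theorem exists_truncation (E : C) (n : ℤ) :
    ∃ (X Y : C) (f : X ⟶ E) (g : E ⟶ Y) (h : Y ⟶ X⟦(1 : ℤ)⟧),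
      Triangle.mk f g h ∈ distTriang C ∧ t.IsLE X n ∧ t.IsGE Y (n + 1) := by
  obtain ⟨X, Y, hX, hY, f, g, h, hT⟩ := t.exists_triangle E n (n + 1) rfl
  exact ⟨X, Y, f, g, h, hT, ⟨hX⟩, ⟨hY⟩⟩

/-- Induction along the truncations of an object that is bounded for the t-structure. -/
theorem bounded_induction {P : C → Prop}
    (pure : ∀ (n : ℤ) (E : C), t.IsLE E n → t.IsGE E n → P E)
    (ext : ∀ (n : ℤ) (X Y Z : C) (f : X ⟶ Y) (g : Y ⟶ Z) (h : Z ⟶ X⟦(1 : ℤ)⟧),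
      Triangle.mk f g h ∈ distTriang C → t.IsLE X n → t.IsGE Z (n + 1) → P X → P Z → P Y)
    {E : C} {a b : ℤ} (ha : t.IsGE E a) (hb : t.IsLE E b) : P E := by
  -- Induction on the amplitude, splitting off the lowest cohomology object each time.
  suffices ∀ (k : ℕ) (a : ℤ) (E : C), t.IsGE E a → t.IsLE E (a + k) → P E from
    this (b - a).toNat a E ha (t.isLE_of_le E b _)
  intro k
  induction k with
  | zero => exact fun a E ha hb => pure a E (by simpa using hb) ha
  | succ k ih =>
    intro a E ha hb
    obtain ⟨X, Y, f, g, h, hT, hX, hY⟩ := t.exists_truncation E a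
    refine ext a X E Y f g h hT hX hY (pure a X hX ?_) (ih (a + 1) Y hY ?_)
    · exact t.isGE₁ hT a ha (t.isGE_of_ge Y (a - 1) (a + 1))
    · have hb' : t.IsLE E (a + 1 + k) := by
        have : a + 1 + (k : ℤ) = a + (k + 1 : ℕ) := by push_cast; ring
        rwa [this]
      exact t.isLE₃ hT _ (t.isLE_of_le X a _) hb'

/-- A function on objects that is additive on truncation triangles, additive on distinguished
triangles in each shift of the heart, and changes sign when a shift of the heart is shifted. -/
structure IsTruncationAdditive (χ : C → G) : Prop where
  truncation : ∀ (n : ℤ) {X Y Z : C} {f : X ⟶ Y} {g : Y ⟶ Z} {h : Z ⟶ X⟦(1 : ℤ)⟧},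
    Triangle.mk f g h ∈ distTriang C → t.IsLE X n → t.IsGE Z (n + 1) → χ Y = χ X + χ Z
  pure : ∀ (n : ℤ) {X Y Z : C} {f : X ⟶ Y} {g : Y ⟶ Z} {h : Z ⟶ X⟦(1 : ℤ)⟧},
    Triangle.mk f g h ∈ distTriang C → t.IsLE X n → t.IsGE X n → t.IsLE Y n → t.IsGE Y n →
      t.IsLE Z n → t.IsGE Z n → χ Y = χ X + χ Z
  shift_pure : ∀ (n : ℤ) (X : C), t.IsLE X n → t.IsGE X n → χ (X⟦(1 : ℤ)⟧) = -χ X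

namespace IsTruncationAdditive

variable {t} {χ : C → G} (hχ : t.IsTruncationAdditive χ)
  (hb : ∀ E : C, ∃ a b : ℤ, t.IsGE E a ∧ t.IsLE E b)

include hχ

theorem isZero {X : C} (hX : IsZero X) : χ X = 0 := by
  have hT : Triangle.mk (𝟙 X) (0 : X ⟶ X) 0 ∈ distTriang C :=
    (Triangle.distinguished_iff_of_isZero₃ _ hX).2 (inferInstanceAs (IsIso (𝟙 X)))
  have := hχ.truncation 0 hT (t.isLE_of_isZero hX 0) (t.isGE_of_isZero hX _)
  simpa using this

/-- The two ends overlap only in degree `n`. Octahedra strip the part of `P` above `n` and the part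
of `M` below `n`, leaving the triangle `M'' ⟶ E₂ ⟶ P'` concentrated in degree `n`. -/
theorem add_of_isLE_of_isGE [IsTriangulated C] (n : ℤ) {M E P : C} {f : M ⟶ E} {g : E ⟶ P}
    {h : P ⟶ M⟦(1 : ℤ)⟧} (hT : Triangle.mk f g h ∈ distTriang C) (hM : t.IsLE M n)
    (hP : t.IsGE P n) : χ E = χ M + χ P := by
  obtain ⟨P', P'', a, b, c, hTP, hP', hP''⟩ := t.exists_truncation P n
  obtain ⟨E₁, v, w, hT₁⟩ := distinguished_cocone_triangle₁ (g ≫ b)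
  have H := someOctahedron' rfl hT hTP hT₁
  have hP'n : t.IsGE P' n := t.isGE₁ hTP n hP (t.isGE_of_ge P'' (n - 1) (n + 1))
  have hE₁ : t.IsLE E₁ n := t.isLE₂ _ H.mem n hM hP'
  obtain ⟨M', M'', a', b', c', hTM, hM', hM''⟩ := t.exists_truncation M (n - 1)
  rw [sub_add_cancel] at hM''
  have hM''n : t.IsLE M'' n := t.isLE₃ hTM n (t.isLE_of_le M' (n - 1) _) hM
  obtain ⟨E₂, v', w', hT₂⟩ := distinguished_cocone_triangle (a' ≫ H.m₁)
  have H' := someOctahedron rfl hTM H.mem hT₂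
  have hE₂ : t.IsLE E₂ n := t.isLE₂ _ H'.mem n hM''n hP'
  have hE₂' : t.IsGE E₂ n := t.isGE₂ _ H'.mem n hM'' hP'n
  have e₁ := hχ.truncation n hT₁ hE₁ hP''
  have e₂ := hχ.truncation n hTP hP' hP''
  have e₃ := hχ.truncation (n - 1) hTM hM' (by rwa [sub_add_cancel])
  have e₄ := hχ.truncation (n - 1) hT₂ hM' (by rwa [sub_add_cancel])
  have e₅ := hχ.pure n H'.mem hM''n hM'' hE₂ hE₂' hP' hP'n
  rw [e₁, e₂, e₃, e₄, e₅]
  abel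

include hb

theorem iso {X Y : C} (e : X ≅ Y) : χ X = χ Y := by
  obtain ⟨a, b, ha, hb'⟩ := hb X
  have hT : Triangle.mk e.hom (0 : Y ⟶ 0) 0 ∈ distTriang C :=
    (Triangle.distinguished_iff_of_isZero₃ _ (isZero_zero C)).2 (inferInstanceAs (IsIso e.hom))
  have := hχ.truncation b hT hb' (t.isGE_of_isZero (isZero_zero C) _)
  rw [this, hχ.isZero (isZero_zero C), add_zero]

theorem shift_one (X : C) : χ (X⟦(1 : ℤ)⟧) = -χ X := by
  obtain ⟨a, b, ha, hb'⟩ := hb X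
  refine t.bounded_induction (P := fun X => χ (X⟦(1 : ℤ)⟧) = -χ X) hχ.shift_pure ?_ ha hb'
  intro n X Y Z f g h hT hX hZ ihX ihZ
  have hT' := Triangle.shift_distinguished _ hT 1
  have e₁ := hχ.truncation (n - 1) hT' (t.isLE_shift X n 1 (n - 1))
    (t.isGE_shift Z (n + 1) 1 (n - 1 + 1))
  have e₂ := hχ.truncation n hT hX hZ
  rw [e₂, neg_add, ← ihX, ← ihZ]
  exact e₁

theorem shift_neg_one (X : C) : χ (X⟦(-1 : ℤ)⟧) = -χ X := by
  have e : (X⟦(-1 : ℤ)⟧)⟦(1 : ℤ)⟧ ≅ X := (shiftEquiv C (1 : ℤ)).counitIso.app X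
  rw [← hχ.iso hb e, hχ.shift_one hb, neg_neg]

/-- Up to shift this is a map in the heart, and `Y` is its cone. Factoring through the image `I`
gives short exact sequences with kernel `K⟦-1⟧` and cokernel `Q`, and the two contributions of `I`
cancel. -/
theorem add_of_pure_pure [IsTriangulated C] (n : ℤ) {W X Y : C} {f : W ⟶ X} {g : X ⟶ Y}
    {h : Y ⟶ W⟦(1 : ℤ)⟧} (hT : Triangle.mk f g h ∈ distTriang C) (hW : t.IsLE W n)
    (hW' : t.IsGE W n) (hX : t.IsLE X n) (hX' : t.IsGE X n) : χ X = χ W + χ Y := by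
  have hY : t.IsLE Y n := t.isLE₃ hT n (t.isLE_of_le W n _) hX
  have hY' : t.IsGE Y (n - 1) := t.isGE₃ hT (n - 1) (by rwa [sub_add_cancel])
    (t.isGE_of_ge X _ n)
  obtain ⟨K, Q, a, b, c, hTY, hK, hQ'⟩ := t.exists_truncation Y (n - 1)
  have e₁ := hχ.truncation (n - 1) hTY hK hQ'
  rw [sub_add_cancel] at hQ'
  have hQ : t.IsLE Q n := t.isLE₃ hTY n (t.isLE_of_le K (n - 1) _) hY
  have hK' : t.IsGE K (n - 1) := t.isGE₁ hTY (n - 1) hY' (t.isGE_of_ge Q _ n)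
  obtain ⟨I, v, w, hTI⟩ := distinguished_cocone_triangle₁ (g ≫ b)
  have H := someOctahedron' rfl hT hTY hTI
  have hI : t.IsLE I n := t.isLE₂ _ H.mem n hW (t.isLE_of_le K (n - 1) n)
  have hI' : t.IsGE I n := t.isGE₁ hTI n hX' (t.isGE_of_ge Q _ n)
  have e₂ := hχ.pure n hTI hI hI' hX hX' hQ hQ'
  have e₃ : χ W = χ (K⟦(-1 : ℤ)⟧) + χ I :=
    hχ.pure n (inv_rot_of_distTriang _ H.mem) (t.isLE_shift K (n - 1) (-1) n)
      (t.isGE_shift K (n - 1) (-1) n) hW hW' hI hI'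
  rw [hχ.shift_neg_one hb] at e₃
  rw [e₁, e₂, e₃]
  abel

/-- In `key`, `X` lies in degrees at most `n` and is replaced by its top cohomology `X₀`. In general
the map from `W` factors through the truncation `X₁`, since it has no component into higher degrees.
-/
theorem add_of_pure [IsTriangulated C] (n : ℤ) {W X Y : C} {f : W ⟶ X} {g : X ⟶ Y}
    {h : Y ⟶ W⟦(1 : ℤ)⟧} (hT : Triangle.mk f g h ∈ distTriang C) (hW : t.IsLE W n)
    (hW' : t.IsGE W n) : χ X = χ W + χ Y := by
  have key : ∀ {X Y : C} {f : W ⟶ X} {g : X ⟶ Y} {h : Y ⟶ W⟦(1 : ℤ)⟧},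
      Triangle.mk f g h ∈ distTriang C → t.IsLE X n → χ X = χ W + χ Y := by
    intro X Y f g h hT hX
    obtain ⟨X', X₀, a, b, c, hTX, hX', hX₀⟩ := t.exists_truncation X (n - 1)
    have e₁ := hχ.truncation (n - 1) hTX hX' hX₀
    rw [sub_add_cancel] at hX₀
    have hX₀' : t.IsLE X₀ n := t.isLE₃ hTX n (t.isLE_of_le X' (n - 1) _) hX
    obtain ⟨V, v, w, hTV⟩ := distinguished_cocone_triangle (f ≫ b)
    have H := someOctahedron rfl hT (rot_of_distTriang _ hTX) hTV
    have e₂ := hχ.add_of_pure_pure hb n hTV hW hW' hX₀' hX₀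
    have hV : t.IsGE V (n - 1) := t.isGE₃ hTV (n - 1) (by rwa [sub_add_cancel])
      (t.isGE_of_ge X₀ _ n)
    have h₁ : t.IsLE (X'⟦(1 : ℤ)⟧) (n - 1 - 1) := t.isLE_shift X' (n - 1) 1 (n - 1 - 1)
    have e₃ : χ Y = χ ((X'⟦(1 : ℤ)⟧)⟦(-1 : ℤ)⟧) + χ V :=
      hχ.add_of_isLE_of_isGE (n - 1) (inv_rot_of_distTriang _ H.mem)
        (t.isLE_shift (X'⟦(1 : ℤ)⟧) (n - 1 - 1) (-1) (n - 1)) hV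
    rw [hχ.shift_neg_one hb, hχ.shift_one hb, neg_neg] at e₃
    rw [e₁, e₂, e₃]
    abel
  obtain ⟨X₁, X₂, a, b, c, hTX, hX₁, hX₂⟩ := t.exists_truncation X n
  obtain ⟨f₁, hf₁⟩ : ∃ f₁ : W ⟶ X₁, f = f₁ ≫ a :=
    Triangle.coyoneda_exact₂ _ hTX f (t.zero_of_isLE_of_isGE _ n (n + 1) (by lia) hW hX₂)
  obtain ⟨Y₁, v, w, hTY₁⟩ := distinguished_cocone_triangle f₁
  have H := someOctahedron hf₁.symm hTY₁ hTX hT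
  have hY₁ : t.IsLE Y₁ n := t.isLE₃ hTY₁ n (t.isLE_of_le W n _) hX₁
  have e₁ := hχ.truncation n hTX hX₁ hX₂
  have e₂ := key hTY₁ hX₁
  have e₃ := hχ.truncation n H.mem hY₁ hX₂
  rw [e₁, e₂, e₃]
  abel

theorem add [IsTriangulated C] {W X Y : C} {f : W ⟶ X} {g : X ⟶ Y}
    {h : Y ⟶ W⟦(1 : ℤ)⟧} (hT : Triangle.mk f g h ∈ distTriang C) : χ X = χ W + χ Y := by
  suffices ∀ {X Y : C} (f : W ⟶ X) (g : X ⟶ Y) (h : Y ⟶ W⟦(1 : ℤ)⟧),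
    Triangle.mk f g h ∈ distTriang C → χ X = χ W + χ Y from this f g h hT
  clear hT f g h
  obtain ⟨a, b, ha, hb'⟩ := hb W
  refine t.bounded_induction (P := fun W => ∀ {X Y : C} (f : W ⟶ X) (g : X ⟶ Y)
    (h : Y ⟶ W⟦(1 : ℤ)⟧), Triangle.mk f g h ∈ distTriang C → χ X = χ W + χ Y)
    (fun n W hW hW' X Y f g h hT => hχ.add_of_pure hb n hT hW hW') ?_ ha hb'
  intro n W' W W'' i p δ hW hW' hW'' ih' ih'' X Y f g h hT
  obtain ⟨Y', v, w, hTY'⟩ := distinguished_cocone_triangle (i ≫ f)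
  have H := someOctahedron rfl hW hT hTY'
  rw [hχ.truncation n hW hW' hW'', ih' _ _ _ hTY', ih'' _ _ _ H.mem]
  abel

end IsTruncationAdditive

section EulerCharacteristic

variable (f : C → G)

/-- The value of `f` on the `n`-th cohomology object of `E`. -/
noncomputable def cohomologyValue (n : ℤ) (E : C) : G :=
  f (((t.truncGE n).obj ((t.truncLE n).obj E))⟦n⟧)

/-- The alternating sum of the values of `f` on the cohomology objects of `E`. -/
noncomputable def eulerChar (E : C) : G :=
  ∑ᶠ n : ℤ, (n.negOnePow : ℤ) • t.cohomologyValue f n E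

variable {t f}

theorem heart_shift (n : ℤ) {E : C} (h₁ : t.IsLE E n) (h₂ : t.IsGE E n) : t.heart (E⟦n⟧) :=
  (t.mem_heart_iff _).2 ⟨t.isLE_shift E n n 0, t.isGE_shift E n n 0⟩

theorem heart_cohomology [IsTriangulated C] (n : ℤ) (E : C) :
    t.heart (((t.truncGE n).obj ((t.truncLE n).obj E))⟦n⟧) :=
  heart_shift n (inferInstanceAs (t.IsLE ((t.truncGELE n n).obj E) n)) inferInstance

variable (hf : ∀ {X Y Z : C} {i : X ⟶ Y} {p : Y ⟶ Z} {δ : Z ⟶ X⟦(1 : ℤ)⟧},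
    Triangle.mk i p δ ∈ distTriang C → t.heart X → t.heart Y → t.heart Z → f Y = f X + f Z)

include hf

theorem value_isZero {X : C} (hX : IsZero X) : f X = 0 := by
  have hT : Triangle.mk (𝟙 X) (0 : X ⟶ X) 0 ∈ distTriang C :=
    (Triangle.distinguished_iff_of_isZero₃ _ hX).2 (inferInstanceAs (IsIso (𝟙 X)))
  have h : t.heart X := (t.mem_heart_iff X).2 ⟨t.isLE_of_isZero hX 0, t.isGE_of_isZero hX 0⟩
  simpa using hf hT h h h

theorem value_iso {X Y : C} (e : X ≅ Y) (hX : t.heart X) : f X = f Y := by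
  have hT : Triangle.mk e.hom (0 : Y ⟶ 0) 0 ∈ distTriang C :=
    (Triangle.distinguished_iff_of_isZero₃ _ (isZero_zero C)).2 (inferInstanceAs (IsIso e.hom))
  have h0 : t.heart (0 : C) := (t.mem_heart_iff _).2 ⟨inferInstance, inferInstance⟩
  rw [hf hT hX (t.heart.prop_of_iso e hX) h0, value_isZero hf (isZero_zero C), add_zero]

theorem cohomologyValue_of_isIso [IsTriangulated C] (n : ℤ) {X Y : C} (g : X ⟶ Y)
    (h : IsIso ((t.truncGE n).map ((t.truncLE n).map g))) :
    t.cohomologyValue f n X = t.cohomologyValue f n Y :=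
  value_iso hf ((shiftFunctor C n).mapIso (asIso ((t.truncGE n).map ((t.truncLE n).map g))))
    (heart_cohomology n X)

theorem cohomologyValue_of_isGE (n : ℤ) {X : C} (h : t.IsGE X (n + 1)) :
    t.cohomologyValue f n X = 0 := by
  refine value_isZero hf ((shiftFunctor C n).map_isZero ((t.truncGE n).map_isZero ?_))
  exact t.isZero_truncLE_obj_of_isGE n (n + 1) rfl X

theorem cohomologyValue_of_isLE (n : ℤ) {X : C} (h : t.IsLE X (n - 1)) :
    t.cohomologyValue f n X = 0 := by
  refine value_isZero hf ((shiftFunctor C n).map_isZero ?_)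
  exact t.isZero_truncGE_obj_of_isLE (n - 1) n (by lia) ((t.truncLE n).obj X)

/-- In each degree `k` one of the two ends has no cohomology, and the other has the cohomology of
`Y`. -/
theorem cohomologyValue_add [IsTriangulated C]
    (n k : ℤ) {X Y Z : C} {i : X ⟶ Y} {p : Y ⟶ Z} {δ : Z ⟶ X⟦(1 : ℤ)⟧}
    (hT : Triangle.mk i p δ ∈ distTriang C) (hX : t.IsLE X n) (hZ : t.IsGE Z (n + 1)) :
    t.cohomologyValue f k Y = t.cohomologyValue f k X + t.cohomologyValue f k Z := by
  by_cases hk : k ≤ n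
  · have hZ' : t.IsGE Z (k + 1) := t.isGE_of_ge Z (k + 1) (n + 1)
    have : IsIso ((t.truncLE k).map i) := t.isIso₁_truncLE_map_of_isGE _ hT k (k + 1) rfl hZ'
    rw [cohomologyValue_of_isGE hf k hZ', add_zero]
    exact (cohomologyValue_of_isIso hf k i inferInstance).symm
  · have hX' : t.IsLE X (k - 1) := t.isLE_of_le X n (k - 1)
    have : IsIso ((t.truncGE k).map p) := t.isIso₂_truncGE_map_of_isLE _ hT (k - 1) k (by lia) hX'
    rw [cohomologyValue_of_isLE hf k hX', zero_add]
    refine cohomologyValue_of_isIso hf k p ?_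
    have h : IsIso ((t.truncLEGE k k).map p) :=
      inferInstanceAs (IsIso ((t.truncLE k).map ((t.truncGE k).map p)))
    -- The two truncations commute, so it suffices that `truncGE` inverts `p`.
    exact (NatIso.isIso_map_iff (t.truncGELEIsoLEGE k k) p).2 h

theorem support_finite {E : C} {a b : ℤ} (ha : t.IsGE E a) (hb : t.IsLE E b) :
    (Function.support fun n : ℤ => (n.negOnePow : ℤ) • t.cohomologyValue f n E).Finite := by
  refine (Set.finite_Icc a b).subset fun n hn => ?_
  by_contra h
  refine hn ?_
  rw [Set.mem_Icc, not_and_or, not_le, not_le] at h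
  have : t.cohomologyValue f n E = 0 := by
    rcases h with h | h
    · exact cohomologyValue_of_isGE hf n (t.isGE_of_ge E (n + 1) a)
    · exact cohomologyValue_of_isLE hf n (t.isLE_of_le E b (n - 1))
  simp [this]

theorem eulerChar_of_pure [IsTriangulated C] (n : ℤ) {E : C} (h₁ : t.IsLE E n) (h₂ : t.IsGE E n) :
    t.eulerChar f E = (n.negOnePow : ℤ) • f (E⟦n⟧) := by
  rw [eulerChar, finsum_eq_single _ n]
  · congr 1
    have : t.IsGE ((t.truncLE n).obj E) n := inferInstance
    exact value_iso hf ((shiftFunctor C n).mapIso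
      ((asIso ((t.truncGEπ n).app ((t.truncLE n).obj E))).symm ≪≫
        asIso ((t.truncLEι n).app E))) (heart_cohomology n E)
  · intro k hk
    have : t.cohomologyValue f k E = 0 := by
      rcases lt_or_gt_of_ne hk with h | h
      · exact cohomologyValue_of_isGE hf k (t.isGE_of_ge E (k + 1) n)
      · exact cohomologyValue_of_isLE hf k (t.isLE_of_le E n (k - 1))
    rw [this, smul_zero]

theorem eulerChar_isTruncationAdditive [IsTriangulated C]
    (hb : ∀ E : C, ∃ a b : ℤ, t.IsGE E a ∧ t.IsLE E b) :
    t.IsTruncationAdditive (t.eulerChar f) where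
  truncation n X Y Z i p δ hT hX hZ := by
    obtain ⟨a, b, h₁, h₂⟩ := hb X
    obtain ⟨a', b', h₁', h₂'⟩ := hb Z
    simp only [eulerChar]
    rw [← finsum_add_distrib (support_finite hf h₁ h₂) (support_finite hf h₁' h₂')]
    refine finsum_congr fun k => ?_
    rw [cohomologyValue_add hf n k hT hX hZ, smul_add]
  pure n X Y Z i p δ hT hX hX' hY hY' hZ hZ' := by
    rw [eulerChar_of_pure hf n hX hX', eulerChar_of_pure hf n hY hY',
      eulerChar_of_pure hf n hZ hZ', ← smul_add]
    congr 1
    exact hf (Triangle.shift_distinguished _ hT n) (heart_shift n hX hX') (heart_shift n hY hY')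
      (heart_shift n hZ hZ')
  shift_pure n X hX hX' := by
    have h₁ := t.isLE_shift X n 1 (n - 1)
    have h₂ := t.isGE_shift X n 1 (n - 1)
    rw [eulerChar_of_pure hf n hX hX', eulerChar_of_pure hf (n - 1) h₁ h₂, Int.negOnePow_sub]
    have e : f (X⟦(1 : ℤ)⟧⟦n - 1⟧) = f (X⟦n⟧) :=
      value_iso hf ((shiftFunctorAdd' C 1 (n - 1) n (by lia)).symm.app X) (heart_shift _ h₁ h₂)
    rw [e]
    simp

/-- An additive function on the heart of a bounded t-structure extends to an additive function on
the Grothendieck group of the triangulated category. -/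
theorem exists_additive_extension [IsTriangulated C]
    (hb : ∀ E : C, ∃ a b : ℤ, t.IsGE E a ∧ t.IsLE E b) :
    ∃ χ : BridgelandStability.K0 C →+ G,
      ∀ E : C, t.heart E → χ (BridgelandStability.K0.cls E) = f E := by
  have hχ := eulerChar_isTruncationAdditive hf hb
  have hle : BridgelandStability.k0Relations C ≤ (FreeAbelianGroup.lift (t.eulerChar f)).ker := by
    rw [BridgelandStability.k0Relations, AddSubgroup.closure_le]
    rintro _ ⟨T, hT, rfl⟩
    simp only [SetLike.mem_coe, AddMonoidHom.mem_ker, map_sub, map_add,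
      FreeAbelianGroup.lift_apply_of]
    rw [hχ.add hb (f := T.mor₁) (g := T.mor₂) (h := T.mor₃) hT, sub_self]
  refine ⟨QuotientAddGroup.lift _ (FreeAbelianGroup.lift (t.eulerChar f)) hle, fun E hE => ?_⟩
  obtain ⟨h₁, h₂⟩ := (t.mem_heart_iff E).1 hE
  have : QuotientAddGroup.lift _ (FreeAbelianGroup.lift (t.eulerChar f)) hle
      (BridgelandStability.K0.cls E) = t.eulerChar f E := by
    simp [BridgelandStability.K0.cls]
  rw [this, eulerChar_of_pure hf 0 h₁ h₂]
  simpa using (value_iso hf ((shiftFunctorZero C ℤ).symm.app E) hE).symm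

end EulerCharacteristic

end CategoryTheory.Triangulated.TStructure

/-! ### Jordan–Hölder multiplicities and finiteness of the set of simples. -/

namespace BridgelandStability

namespace StabilityCondition

variable {C : Type u} [Category.{v} C] [Preadditive C] [HasZeroObject C] [HasShift C ℤ]
  [∀ n : ℤ, (shiftFunctor C n).Additive] [Pretriangulated C]
  {σ : StabilityCondition C}

theorem SES.comp_iso_mid {X Y Z : σ.Heart} {i : X ⟶ Y} {p : Y ⟶ Z} (h : SES i p) {W : σ.Heart}
    (e : Y ≅ W) : SES (i ≫ e.hom) (e.inv ≫ p) := by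
  obtain ⟨δ, hT⟩ := h
  let e' : Y.obj ≅ W.obj := σ.heartι.mapIso e
  refine ⟨δ, isomorphic_distinguished _ hT _
    (Triangle.isoMk _ _ (Iso.refl _) e'.symm (Iso.refl _) ?_ ?_ ?_)⟩
  · exact (((Category.assoc i.hom e'.hom e'.inv).trans ((congrArg (i.hom ≫ ·) e'.hom_inv_id).trans
      (Category.comp_id i.hom))).trans (Category.id_comp i.hom).symm)
  · exact Category.comp_id (e'.inv ≫ p.hom)
  · exact ((congrArg (δ ≫ ·) ((shiftFunctor C (1 : ℤ)).map_id X.obj)).trans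
      (Category.comp_id _)).trans (Category.id_comp δ).symm

/-- The free abelian group on the isomorphism classes of objects of the heart. -/
abbrev HeartClasses (σ : StabilityCondition C) : Type u :=
  Quotient (isIsomorphicSetoid σ.Heart) →₀ ℤ

/-- The class of an object of the heart. -/
noncomputable def single (X : σ.Heart) : HeartClasses σ :=
  Finsupp.single (Quotient.mk (isIsomorphicSetoid σ.Heart) X) 1

theorem single_eq_of_iso {X Y : σ.Heart} (e : X ≅ Y) : single X = single Y := by
  unfold single
  rw [Quotient.sound (s := isIsomorphicSetoid σ.Heart) (show IsIsomorphic X Y from ⟨e⟩)]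

/-- `Mult Y g`: the object `Y` has a composition series in which the simple objects occur with
the multiplicities recorded by `g`. -/
inductive Mult : σ.Heart → HeartClasses σ → Prop
  | zero (X : σ.Heart) (hX : IsZero X) : Mult X 0
  | step {T Y X : σ.Heart} (i : T ⟶ Y) (p : Y ⟶ X) (h : SES i p) (hT : Simple T)
      (g : HeartClasses σ) (hX : Mult X g) : Mult Y (single T + g)

theorem Mult.of_iso {X Y : σ.Heart} (e : X ≅ Y) {g : HeartClasses σ} (h : Mult X g) : Mult Y g := by
  cases h with
  | zero _ hX => exact .zero _ (hX.of_iso e.symm)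
  | step i p h hT g hX => exact .step _ _ (h.comp_iso_mid e) hT g hX

variable [IsTriangulated C]

variable (σ) in
/-- A function on the heart with values in `ℕ` that decreases strictly when passing to a proper
subobject or to a proper quotient. -/
structure IsSize (size : σ.Heart → ℕ) : Prop where
  sub_lt : ∀ {X Y Z : σ.Heart} {i : X ⟶ Y} {p : Y ⟶ Z}, SES i p → ¬ IsZero Z → size X < size Y
  quot_lt : ∀ {X Y Z : σ.Heart} {i : X ⟶ Y} {p : Y ⟶ Z}, SES i p → ¬ IsZero X → size Z < size Y

theorem exists_ses_of_lt {Y : σ.Heart} {S T : Subobject Y} (h : S < T) :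
    ∃ (Q : σ.Heart) (p : (T : σ.Heart) ⟶ Q), SES (S.ofLE T h.le) p ∧ ¬ IsZero Q := by
  obtain ⟨Q, p, hp⟩ := SES.of_mono (S.ofLE T h.le)
  refine ⟨Q, p, hp, fun hQ => ?_⟩
  have := hp.isZero_right_iff.1 hQ
  refine h.not_ge (Subobject.le_of_comm (inv (S.ofLE T h.le)) ?_)
  rw [IsIso.inv_comp_eq, Subobject.ofLE_arrow]

namespace IsSize

variable {size : σ.Heart → ℕ} (hs : σ.IsSize size)

include hs

theorem strictMono (Y : σ.Heart) : StrictMono fun S : Subobject Y => size (S : σ.Heart) := by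
  intro S T h
  obtain ⟨Q, p, hp, hQ⟩ := exists_ses_of_lt h
  exact hs.sub_lt hp hQ

theorem isArtinianObject (Y : σ.Heart) : IsArtinianObject Y :=
  ⟨(hs.strictMono Y).wellFoundedLT⟩

theorem isNoetherianObject (Y : σ.Heart) : IsNoetherianObject Y := by
  have : StrictAnti fun S : Subobject Y =>
      size ((⊤ : Subobject Y) : σ.Heart) - size (S : σ.Heart) := by
    intro S T h
    have h₁ := hs.strictMono Y h
    have h₂ := (hs.strictMono Y).monotone (le_top (a := T))
    simp only at h₁ h₂ ⊢
    lia
  exact ⟨this.wellFoundedGT⟩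

end IsSize

namespace Mult

theorem add {X Y Z : σ.Heart} {i : X ⟶ Y} {p : Y ⟶ Z} (h : SES i p) {a b : HeartClasses σ}
    (hX : Mult X a) (hZ : Mult Z b) : Mult Y (a + b) := by
  induction hX generalizing Y with
  | zero X hX =>
    have := h.isZero_left_iff.1 hX
    rw [zero_add]
    exact hZ.of_iso (asIso p).symm
  | step j s hj hT g hX' ih =>
    have := hj.mono
    have := h.mono
    obtain ⟨Y', r, hr⟩ := SES.of_mono (j ≫ i)
    obtain ⟨a, b, hab⟩ := hj.quotient h hr
    rw [add_assoc]
    exact .step _ _ hr hT _ (ih hab)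

variable {size : σ.Heart → ℕ} (hs : σ.IsSize size)

include hs

theorem exists_mult (Y : σ.Heart) : ∃ g, Mult Y g := by
  induction hn : size Y using Nat.strong_induction_on generalizing Y with
  | _ n ih =>
    by_cases hY : IsZero Y
    · exact ⟨0, .zero Y hY⟩
    have := hs.isArtinianObject Y
    obtain ⟨T, hT⟩ := exists_simple_subobject hY
    obtain ⟨X, p, h⟩ := SES.of_mono T.arrow
    obtain ⟨g, hg⟩ := ih _ (hn ▸ hs.quot_lt h (Simple.not_isZero _)) X rfl
    exact ⟨_, .step _ _ h hT g hg⟩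

/-- Jordan–Hölder by induction on size. If the first simple subobjects of the two series agree, the
quotients are compared directly. Otherwise they meet in zero, and both series are compared with
series passing through the quotient `K` of `Y` by their sum. -/
theorem unique {Y : σ.Heart} {g g' : HeartClasses σ} (h : Mult Y g) (h' : Mult Y g') : g = g' := by
  induction hn : size Y using Nat.strong_induction_on generalizing Y g g' with
  | _ n ih =>
    subst hn
    have aux : ∀ {T Y X : σ.Heart} {i : T ⟶ Y} {p : Y ⟶ X}, SES i p → Simple T → ¬ IsZero Y := by
      intro T Y X i p h hT hY
      have := h.mono
      exact Simple.not_isZero T (IsZero.of_mono i hY)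
    cases h with
    | zero _ hY =>
      cases h' with
      | zero => rfl
      | step i p h hT g hX => exact absurd hY (aux h hT)
    | @step T₁ _ X₁ i₁ p₁ h₁ hT₁ g₁ hX₁ =>
      cases h' with
      | zero _ hY => exact absurd hY (aux h₁ hT₁)
      | @step T₂ _ X₂ i₂ p₂ h₂ hT₂ g₂ hX₂ =>
        have lt₁ := hs.quot_lt h₁ (Simple.not_isZero _)
        have lt₂ := hs.quot_lt h₂ (Simple.not_isZero _)
        have := h₁.mono
        have := h₂.mono
        have := h₁.epi
        have := h₂.epi
        -- Vanishing means that `T₁` lies inside `T₂`, hence equals it by simplicity.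
        by_cases hz : i₁ ≫ p₂ = 0
        · obtain ⟨k, hk⟩ := h₂.exists_lift i₁ hz
          have hk0 : k ≠ 0 := by
            rintro rfl
            rw [zero_comp] at hk
            exact Simple.not_isZero T₁ ((IsZero.iff_id_eq_zero _).2
              (by rw [← cancel_mono i₁, ← hk]; simp))
          have := isIso_of_hom_simple hk0
          have hk' : i₂ = inv k ≫ i₁ := by rw [← hk, IsIso.inv_hom_id_assoc]
          obtain ⟨e, -⟩ := h₂.iso_right (q := p₁) (by rw [hk', Category.assoc, h₁.zero, comp_zero])
            (fun x hx => h₁.exists_desc x (by rw [← hk, Category.assoc, hx, comp_zero]))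
          rw [single_eq_of_iso (asIso k), ih _ lt₁ hX₁ (hX₂.of_iso e) rfl]
        · have := mono_of_nonzero_from_simple hz
          obtain ⟨K, r, hr⟩ := SES.of_mono (i₁ ≫ p₂)
          have := hr.epi
          obtain ⟨q, hq⟩ := h₁.exists_desc (p₂ ≫ r) (by rw [← Category.assoc, hr.zero])
          have hz' : i₂ ≫ p₁ ≠ 0 := by
            intro hz'
            obtain ⟨k, hk⟩ := h₁.exists_lift i₂ hz'
            have hk0 : k ≠ 0 := by
              rintro rfl
              rw [zero_comp] at hk
              exact Simple.not_isZero T₂ ((IsZero.iff_id_eq_zero _).2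
                (by rw [← cancel_mono i₂, ← hk]; simp))
            have := isIso_of_hom_simple hk0
            have hk' : i₁ = inv k ≫ i₂ := by rw [← hk, IsIso.inv_hom_id_assoc]
            exact hz (by rw [hk', Category.assoc, h₂.zero, comp_zero])
          have := mono_of_nonzero_from_simple hz'
          obtain ⟨K', r', hr'⟩ := SES.of_mono (i₂ ≫ p₁)
          have : Epi (p₁ ≫ q) := by rw [hq]; infer_instance
          have : Epi q := epi_of_epi p₁ q
          -- Both iterated quotients, by `T₁` then `T₂` and by `T₂` then `T₁`, have the same
          -- universal property.
          obtain ⟨e, he⟩ := hr'.iso_right (q := q)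
            (by rw [Category.assoc, hq, reassoc_of% h₂.zero, zero_comp])
            (fun x hx => by
              obtain ⟨y, hy⟩ := h₂.exists_desc (p₁ ≫ x) (by rw [← Category.assoc, hx])
              obtain ⟨z, hz⟩ := hr.exists_desc y
                (by rw [Category.assoc, hy, reassoc_of% h₁.zero, zero_comp])
              exact ⟨z, by rw [← cancel_epi p₁, reassoc_of% hq, hz, hy]⟩)
          have hr'' : SES (i₂ ≫ p₁) q := he ▸ hr'.comp_iso_right e
          obtain ⟨k, hk⟩ := exists_mult hs K
          rw [ih _ lt₁ hX₁ (.step _ _ hr'' hT₂ k hk) rfl, ih _ lt₂ hX₂ (.step _ _ hr hT₁ k hk) rfl]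
          abel

end Mult

theorem IsSize.exists_classes {size : σ.Heart → ℕ} (hs : σ.IsSize size) :
    ∃ χ : K0 C →+ HeartClasses σ, ∀ T : σ.Heart, Simple T → χ (K0.cls T.obj) = single T := by
  classical
  choose m hm using Mult.exists_mult hs
  let f : C → HeartClasses σ := fun E =>
    if h : σ.interval (Set.Ioc 0 1) E then m ⟨E, h⟩ else 0
  have hf : ∀ X : σ.Heart, f X.obj = m X := fun X => dif_pos X.property
  obtain ⟨χ, hχ⟩ := Triangulated.TStructure.exists_additive_extension (t := σ.tStructure) (f := f)
    (by
      intro X Y Z i p δ hT hX hY hZ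
      rw [σ.tStructure_heart] at hX hY hZ
      have h : SES (σ := σ) (X := ⟨X, hX⟩) (Y := ⟨Y, hY⟩) (Z := ⟨Z, hZ⟩)
        (ObjectProperty.homMk i) (ObjectProperty.homMk p) := ⟨δ, hT⟩
      exact (hf ⟨Y, hY⟩).trans ((Mult.unique hs (hm _) (Mult.add h (hm _) (hm _))).trans
        (congrArg₂ (· + ·) (hf ⟨X, hX⟩).symm (hf ⟨Z, hZ⟩).symm)))
    σ.tStructure_bounded
  refine ⟨χ, fun T hT => ?_⟩
  rw [hχ _ (by rw [σ.tStructure_heart]; exact T.property), hf]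
  refine Mult.unique hs (hm T) ?_
  obtain ⟨Z, p, h⟩ := SES.of_mono (𝟙 T)
  simpa using Mult.step _ _ h hT 0 (.zero Z (h.isZero_right_iff.2 inferInstance))

/-- The multiplicity map sends simples to distinct basis vectors of a free group. It kills torsion,
so their classes are already independent in the finitely generated quotient. -/
theorem IsSize.finite_simples {size : σ.Heart → ℕ} (hs : σ.IsSize size)
    (hK : Module.Finite ℤ (K0 C ⧸ Submodule.torsion ℤ (K0 C))) :
    {s : Quotient (isIsomorphicSetoid σ.Heart) | ∃ S : σ.Heart, Simple S ∧
      Quotient.mk _ S = s}.Finite := by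
  obtain ⟨χ, hχ⟩ := hs.exists_classes
  set A := {s : Quotient (isIsomorphicSetoid σ.Heart) | ∃ S : σ.Heart, Simple S ∧
      Quotient.mk _ S = s}
  have htors : Submodule.torsion ℤ (K0 C) ≤ LinearMap.ker χ.toIntLinearMap := by
    intro x hx
    obtain ⟨⟨n, hn⟩, hnx⟩ := (Submodule.mem_torsion_iff x).1 hx
    have h0 : n • χ x = 0 := by
      rw [← map_zsmul]
      exact (congrArg χ hnx).trans (map_zero χ)
    exact (smul_eq_zero.1 h0).resolve_left (nonZeroDivisors.ne_zero hn)
  let χ' := (Submodule.torsion ℤ (K0 C)).liftQ χ.toIntLinearMap htors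
  choose S hS hS' using fun s : A => s.2
  have hli : LinearIndependent ℤ fun s : A =>
      (Submodule.torsion ℤ (K0 C)).mkQ (K0.cls (S s).obj) := by
    apply LinearIndependent.of_comp χ'
    have : (χ' ∘ fun s : A => (Submodule.torsion ℤ (K0 C)).mkQ (K0.cls (S s).obj)) =
        (fun s => Finsupp.single s (1 : ℤ)) ∘ (Subtype.val : A → _) := by
      ext1 s
      simp only [Function.comp_apply, χ', Submodule.mkQ_apply, Submodule.liftQ_apply,
        AddMonoidHom.coe_toIntLinearMap]
      rw [hχ _ (hS s), single, hS' s]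
    rw [this]
    exact (Finsupp.linearIndependent_single_one ℤ _).comp _ Subtype.val_injective
  have := hli.finite
  exact Set.toFinite A

end StabilityCondition

end BridgelandStability

/-! ### Lower bounds from the support property, and the size function. -/

namespace BridgelandStability

section Norm

theorem exists_linear_bound {V : Type*} [AddCommGroup V] [Module ℝ V] [Module.Finite ℝ V]
    (N : Seminorm ℝ V) (hN : ∀ x, N x = 0 → x = 0) (φ : V →ₗ[ℝ] ℝ) :
    ∃ M : ℝ, 0 < M ∧ ∀ x, |φ x| ≤ M * N x := by
  let _ : Norm V := ⟨N⟩
  have core : NormedSpace.Core ℝ V :=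
    { norm_nonneg := apply_nonneg N
      norm_smul := fun c x => map_smul_eq_mul N c x
      norm_triangle := map_add_le_add N
      norm_eq_zero_iff := fun x => ⟨hN x, fun h => by rw [h]; exact map_zero N⟩ }
  let _ : NormedAddCommGroup V := NormedAddCommGroup.ofCore core
  let _ : NormedSpace ℝ V := NormedSpace.ofCore core
  obtain ⟨M, hM, h⟩ := (LinearMap.toContinuousLinearMap φ).isBoundedLinearMap.bound
  exact ⟨M, hM, h⟩

/-- In a norm on `ℝ ⊗ K`, where `K` is an abelian group of finite rank modulo torsion, the elements
of `K` that are not torsion have norm bounded below. -/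
theorem exists_lower_bound_of_notMem_torsion {K : Type*} [AddCommGroup K]
    (hK : Module.Finite ℤ (K ⧸ Submodule.torsion ℤ K)) (N : Seminorm ℝ (ℝ ⊗[ℤ] K))
    (hN : ∀ x, N x = 0 → x = 0) :
    ∃ μ : ℝ, 0 < μ ∧ ∀ α : K, α ∉ Submodule.torsion ℤ K → μ ≤ N ((1 : ℝ) ⊗ₜ[ℤ] α) := by
  have : Module.Free ℤ (K ⧸ Submodule.torsion ℤ K) := Module.free_of_finite_type_torsion_free'
  let b := Module.Free.chooseBasis ℤ (K ⧸ Submodule.torsion ℤ K)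
  set ι := Module.Free.ChooseBasisIndex ℤ (K ⧸ Submodule.torsion ℤ K)
  choose β hβ using fun i : ι => Submodule.mkQ_surjective (Submodule.torsion ℤ K) (b i)
  let c : ι → K →ₗ[ℤ] ℝ := fun i =>
    (Algebra.linearMap ℤ ℝ) ∘ₗ (b.coord i) ∘ₗ (Submodule.torsion ℤ K).mkQ
  -- The real extension of the `i`-th integral coordinate. On a nontorsion class some coordinate is
  -- a nonzero integer, so has absolute value at least one.
  let Φ : ι → ℝ ⊗[ℤ] K →ₗ[ℝ] ℝ := fun i =>
    TensorProduct.AlgebraTensorModule.lift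
      { toFun := fun r => r • c i
        map_add' := fun r s => add_smul r s _
        map_smul' := fun r s => mul_smul r s _ }
  have hΦ : ∀ i α, Φ i ((1 : ℝ) ⊗ₜ[ℤ] α) =
      ((b.repr ((Submodule.torsion ℤ K).mkQ α) i : ℤ) : ℝ) := by
    intro i α
    simp [Φ, c]
  have hmem : ∀ x : K, x ∈ Submodule.torsion ℤ K ↔ (Submodule.torsion ℤ K).mkQ x = 0 := fun x =>
    (Submodule.Quotient.mk_eq_zero _).symm
  have htors : ∀ α ∈ Submodule.torsion ℤ K, (1 : ℝ) ⊗ₜ[ℤ] α = 0 := by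
    intro α hα
    obtain ⟨⟨n, hn⟩, hnα⟩ := (Submodule.mem_torsion_iff α).1 hα
    have hn0 : (n : ℝ) ≠ 0 := Int.cast_ne_zero.2 (nonZeroDivisors.ne_zero hn)
    have h : ((n : ℝ)⁻¹ * n) ⊗ₜ[ℤ] α = (n : ℝ)⁻¹ ⊗ₜ[ℤ] (n • α) := by
      rw [← TensorProduct.smul_tmul, zsmul_eq_mul, mul_comm]
    rw [inv_mul_cancel₀ hn0] at h
    have hnα' : n • α = 0 := hnα
    rw [h, hnα', TensorProduct.tmul_zero]
  have hspan : ∀ α : K, (1 : ℝ) ⊗ₜ[ℤ] α ∈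
      Submodule.span ℝ (Set.range fun i => (1 : ℝ) ⊗ₜ[ℤ] β i) := by
    intro α
    have h : α - ∑ i, b.repr ((Submodule.torsion ℤ K).mkQ α) i • β i ∈ Submodule.torsion ℤ K := by
      rw [hmem, map_sub, map_sum]
      simp only [map_zsmul, hβ]
      rw [b.sum_repr, sub_self]
    have h' := htors _ h
    rw [TensorProduct.tmul_sub, sub_eq_zero, TensorProduct.tmul_sum] at h'
    rw [h']
    refine Submodule.sum_mem _ fun i _ => ?_
    rw [TensorProduct.tmul_smul]
    exact zsmul_mem (Submodule.subset_span (Set.mem_range_self i)) _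
  have hfin : Module.Finite ℝ (ℝ ⊗[ℤ] K) := by
    refine ⟨Submodule.fg_def.2 ⟨_, Set.finite_range fun i => (1 : ℝ) ⊗ₜ[ℤ] β i, ?_⟩⟩
    rw [eq_top_iff]
    rintro x -
    induction x with
    | zero => exact Submodule.zero_mem _
    | add x y hx hy => exact Submodule.add_mem _ hx hy
    | tmul r α =>
      have : r ⊗ₜ[ℤ] α = r • ((1 : ℝ) ⊗ₜ[ℤ] α) := by
        rw [TensorProduct.smul_tmul', smul_eq_mul, mul_one]
      rw [this]
      exact Submodule.smul_mem _ _ (hspan α)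
  choose M hM hMb using fun i => exists_linear_bound N hN (Φ i)
  have hsum : ∀ i, M i ≤ 1 + ∑ j, M j := fun i =>
    (Finset.single_le_sum (fun j _ => (hM j).le) (Finset.mem_univ i)).trans (by linarith)
  have hpos : 0 < 1 + ∑ j, M j :=
    add_pos_of_pos_of_nonneg one_pos (Finset.sum_nonneg fun j _ => (hM j).le)
  -- The sum dominates every `M i`; the summand `1` keeps it positive when there are no coordinates.
  refine ⟨(1 + ∑ j, M j)⁻¹, inv_pos.2 hpos, fun α hα => ?_⟩
  obtain ⟨i, hi⟩ : ∃ i, b.repr ((Submodule.torsion ℤ K).mkQ α) i ≠ 0 := by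
    by_contra! h
    apply hα
    rw [hmem]
    exact b.repr.map_eq_zero_iff.1 (Finsupp.ext h)
  have h₁ : (1 : ℝ) ≤ |Φ i ((1 : ℝ) ⊗ₜ[ℤ] α)| := by
    rw [hΦ, ← Int.cast_abs]
    exact_mod_cast Int.one_le_abs hi
  rw [inv_le_iff_one_le_mul₀' hpos]
  exact h₁.trans ((hMb i _).trans (mul_le_mul_of_nonneg_right (hsum i) (apply_nonneg N _)))

end Norm

section Classes

variable {C : Type u} [Category.{v} C] [Preadditive C] [HasZeroObject C] [HasShift C ℤ]
  [∀ n : ℤ, (shiftFunctor C n).Additive] [Pretriangulated C]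

open scoped ZeroObject

theorem K0.cls_isZero {X : C} (hX : IsZero X) : K0.cls X = 0 := by
  have hT : Triangle.mk (𝟙 X) (0 : X ⟶ X) 0 ∈ distTriang C :=
    (Triangle.distinguished_iff_of_isZero₃ _ hX).2 (inferInstanceAs (IsIso (𝟙 X)))
  simpa using K0.cls_of_distTriang hT

theorem K0.cls_iso {X Y : C} (e : X ≅ Y) : K0.cls X = K0.cls Y := by
  have hT : Triangle.mk e.hom (0 : Y ⟶ 0) 0 ∈ distTriang C :=
    (Triangle.distinguished_iff_of_isZero₃ _ (isZero_zero C)).2 (inferInstanceAs (IsIso e.hom))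
  have h : K0.cls Y = K0.cls X + K0.cls (0 : C) := K0.cls_of_distTriang hT
  rw [h, K0.cls_isZero (isZero_zero C), add_zero]

end Classes

/-- The imaginary part of `exp (-iθ) z`. -/
noncomputable def rotatedIm (θ : ℝ) : ℂ →+ ℝ where
  toFun z := z.im * Real.cos θ - z.re * Real.sin θ
  map_zero' := by simp
  map_add' z w := by simp only [Complex.add_im, Complex.add_re]; ring

theorem rotatedIm_apply (θ : ℝ) (z : ℂ) :
    rotatedIm θ z = z.im * Real.cos θ - z.re * Real.sin θ := rfl

theorem rotatedIm_polar (θ m φ : ℝ) :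
    rotatedIm θ (m * Complex.exp (Complex.I * Real.pi * φ)) = m * Real.sin (Real.pi * φ - θ) := by
  have h : Complex.I * Real.pi * φ = ((Real.pi * φ : ℝ) : ℂ) * Complex.I := by
    push_cast; ring
  rw [h, rotatedIm_apply, Complex.re_ofReal_mul, Complex.im_ofReal_mul,
    Complex.exp_ofReal_mul_I_re, Complex.exp_ofReal_mul_I_im, Real.sin_sub]
  ring

theorem norm_polar {m : ℝ} (hm : 0 < m) (φ : ℝ) :
    ‖(m : ℂ) * Complex.exp (Complex.I * Real.pi * φ)‖ = m := by
  have h : Complex.I * Real.pi * φ = ((Real.pi * φ : ℝ) : ℂ) * Complex.I := by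
    push_cast; ring
  rw [h, norm_mul, Complex.norm_exp_ofReal_mul_I, mul_one, Complex.norm_real, Real.norm_eq_abs,
    abs_of_pos hm]

theorem sin_le_sin_of_mem_Icc {θ x : ℝ} (hθ : 0 ≤ θ) (h : θ ≤ x) (h' : x ≤ Real.pi - θ) :
    Real.sin θ ≤ Real.sin x := by
  rcases le_total x (Real.pi / 2) with hx | hx
  · exact Real.sin_le_sin_of_le_of_le_pi_div_two (by linarith [Real.pi_pos]) hx h
  · rw [← Real.sin_pi_sub x]
    exact Real.sin_le_sin_of_le_of_le_pi_div_two (by linarith [Real.pi_pos]) (by linarith)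
      (by linarith)

namespace StabilityCondition

variable {C : Type u} [Category.{v} C] [Preadditive C] [HasZeroObject C] [HasShift C ℤ]
  [∀ n : ℤ, (shiftFunctor C n).Additive] [Pretriangulated C]
  (σ : StabilityCondition C)

/-- A convexity principle: a lower bound for the value of an additive function on nonzero semistable
objects holds for all nonzero objects that they generate. -/
theorem le_of_interval {I : Set ℝ} {κ : ℝ} (hκ : 0 ≤ κ) (L : K0 C →+ ℝ)
    (h : ∀ φ ∈ I, ∀ X, σ.P φ X → ¬ IsZero X → κ ≤ L (K0.cls X)) {X : C} (hX : σ.interval I X)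
    (hX0 : ¬ IsZero X) : κ ≤ L (K0.cls X) := by
  suffices IsZero X ∨ κ ≤ L (K0.cls X) from this.resolve_left hX0
  clear hX0
  induction hX with
  | zero X hX => exact .inl hX
  | of X hX =>
    obtain ⟨φ, hφ, hX⟩ := hX
    exact or_iff_not_imp_left.2 (h φ hφ X hX)
  | ext T hT _ _ h₁ h₃ =>
    rw [K0.cls_of_distTriang hT, map_add]
    rcases h₁ with h₁ | h₁ <;> rcases h₃ with h₃ | h₃
    · exact .inl (Triangle.isZero₂_of_isZero₁₃ _ hT h₁ h₃)
    · rw [K0.cls_isZero h₁, map_zero, zero_add]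
      exact .inr h₃
    · rw [K0.cls_isZero h₃, map_zero, add_zero]
      exact .inr h₁
    · exact .inr (by linarith)

theorem isZero_of_interval_of_P {I : Set ℝ} (h : ∀ φ ∈ I, ∀ X, σ.P φ X → IsZero X) {X : C}
    (hX : σ.interval I X) : IsZero X := by
  by_contra hX0
  -- With no nonzero generators the bound holds vacuously even for `κ = 1` and the zero function,
  -- which gives `1 ≤ 0`.
  have := σ.le_of_interval zero_le_one 0 (fun φ hφ X hX hX0 => absurd (h φ hφ X hX) hX0) hX hX0
  simp only [AddMonoidHom.zero_apply] at this
  linarith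

theorem cls_notMem_torsion {φ : ℝ} {X : C} (hX : σ.P φ X) (hX0 : ¬ IsZero X) :
    K0.cls X ∉ Submodule.torsion ℤ (K0 C) := by
  intro h
  obtain ⟨⟨n, hn⟩, hnx⟩ := (Submodule.mem_torsion_iff _).1 h
  obtain ⟨m, hm, hZ⟩ := σ.charge φ X hX hX0
  have h0 : n • σ.Z (K0.cls X) = 0 := by
    rw [← map_zsmul]
    exact (congrArg σ.Z hnx).trans (map_zero σ.Z)
  have h1 := (smul_eq_zero.1 h0).resolve_left (nonZeroDivisors.ne_zero hn)
  have h2 := norm_polar hm φ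
  rw [← hZ, h1, norm_zero] at h2
  exact hm.ne h2

/-- The size is the integer part of the rotated imaginary part of the charge, measured in units of
its least possible value `κ` on nonzero objects. -/
theorem exists_size [IsTriangulated C]
    (hK : Module.Finite ℤ (K0 C ⧸ Submodule.torsion ℤ (K0 C))) (N : Seminorm ℝ (ℝ ⊗[ℤ] K0 C))
    (hN : ∀ x, N x = 0 → x = 0) (hσ : σ.SupportProperty N) {δ : ℝ} (hδ : 0 < δ)
    (hP : ∀ X : C, σ.interval (Set.Ioo 0 δ) X → IsZero X) :
    ∃ size : σ.Heart → ℕ, σ.IsSize size := by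
  wlog hδ1 : δ ≤ 1 generalizing δ
  · exact this one_pos (fun X hX => hP X
      (σ.interval_mono (Set.Ioo_subset_Ioo_right (not_le.1 hδ1).le) X hX)) le_rfl
  obtain ⟨ε, hε, hsupp⟩ := hσ
  obtain ⟨μ, hμ, hlow⟩ := exists_lower_bound_of_notMem_torsion hK N hN
  have hπ := Real.pi_pos
  -- Half the gap: phases in `[δ, 1]` become angles in `[θ, π - θ]`, where the sine is at least `sin
  -- θ`.
  set θ := Real.pi * (δ / 2) with hθ
  have hθ0 : 0 < θ := by positivity
  have hsin : 0 < Real.sin θ := Real.sin_pos_of_pos_of_lt_pi hθ0 (by rw [hθ]; nlinarith)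
  let L : K0 C →+ ℝ := (rotatedIm θ).comp σ.Z
  set κ := ε * μ * Real.sin θ
  have hκ : 0 < κ := by positivity
  have hL : ∀ X : σ.Heart, ¬ IsZero X → κ ≤ L (K0.cls X.obj) := by
    intro X hX
    refine σ.le_of_interval hκ.le L ?_ X.property (fun h => hX (heart_isZero_iff.2 h))
    intro φ hφ E hE hE0
    have hδφ : δ ≤ φ := by
      by_contra! h
      exact hE0 (hP E (σ.interval_of_P hE ⟨hφ.1, h⟩))
    obtain ⟨m, hm, hZ⟩ := σ.charge φ E hE hE0
    have h₁ := hlow _ (σ.cls_notMem_torsion hE hE0)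
    have h₂ := hsupp _ ⟨φ, E, hE, hE0, rfl⟩
    have h₃ : L (K0.cls E) = m * Real.sin (Real.pi * φ - θ) := by
      rw [← rotatedIm_polar, ← hZ]
      rfl
    rw [hZ, norm_polar hm] at h₂
    rw [h₃]
    have h₄ : ε * μ ≤ m := (mul_le_mul_of_nonneg_left h₁ hε.le).trans h₂.le
    refine mul_le_mul h₄ (sin_le_sin_of_mem_Icc hθ0.le ?_ ?_) hsin.le hm.le
    · rw [hθ]; nlinarith
    · have := hφ.2
      nlinarith
  have hL0 : ∀ X : σ.Heart, 0 ≤ L (K0.cls X.obj) := by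
    intro X
    by_cases hX : IsZero X
    · rw [K0.cls_isZero (heart_isZero_iff.1 hX), map_zero]
    · exact hκ.le.trans (hL X hX)
  have key : ∀ x y : ℝ, 0 ≤ x → κ ≤ y → ⌊x / κ⌋₊ < ⌊(x + y) / κ⌋₊ := by
    intro x y hx hy
    have h : x / κ + 1 ≤ (x + y) / κ := by
      rw [add_div]
      gcongr
      rwa [one_le_div hκ]
    have := Nat.floor_le_floor h
    rw [Nat.floor_add_one (by positivity)] at this
    lia
  refine ⟨fun X => ⌊L (K0.cls X.obj) / κ⌋₊, fun {X Y Z i p} h hZ => ?_, fun {X Y Z i p} h hX => ?_⟩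
  · rw [h.cls, map_add]
    exact key _ _ (hL0 X) (hL Z hZ)
  · rw [h.cls, map_add, add_comm]
    exact key _ _ (hL0 Z) (hL X hX)

end StabilityCondition

end BridgelandStability

/-! ### From an algebraic heart to a gap in the phases. -/

namespace BridgelandStability

open scoped ZeroObject

namespace StabilityCondition

variable {C : Type u} [Category.{v} C] [Preadditive C] [HasZeroObject C] [HasShift C ℤ]
  [∀ n : ℤ, (shiftFunctor C n).Additive] [Pretriangulated C]
  {σ : StabilityCondition C}

theorem heart_cls_iso {X Y : σ.Heart} (e : X ≅ Y) : K0.cls X.obj = K0.cls Y.obj :=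
  K0.cls_iso (σ.heartι.mapIso e)

/-- The open upper half plane together with the negative real axis is closed under addition, so the
claim passes from semistable objects to extensions. -/
theorem charge_mem_upperHalf {X : C} (hX : σ.interval (Set.Ioc 0 1) X) (hX0 : ¬ IsZero X) :
    0 < (σ.Z (K0.cls X)).im ∨ (σ.Z (K0.cls X)).im = 0 ∧ (σ.Z (K0.cls X)).re < 0 := by
  suffices IsZero X ∨ (0 < (σ.Z (K0.cls X)).im ∨
    (σ.Z (K0.cls X)).im = 0 ∧ (σ.Z (K0.cls X)).re < 0) from this.resolve_left hX0
  clear hX0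
  induction hX with
  | zero X hX => exact .inl hX
  | of X hX =>
    obtain ⟨φ, hφ, hX⟩ := hX
    refine or_iff_not_imp_left.2 fun hX0 => ?_
    obtain ⟨m, hm, hZ⟩ := σ.charge φ X hX hX0
    have h : Complex.I * Real.pi * φ = ((Real.pi * φ : ℝ) : ℂ) * Complex.I := by
      push_cast; ring
    rw [hZ, h, Complex.re_ofReal_mul, Complex.im_ofReal_mul,
      Complex.exp_ofReal_mul_I_re, Complex.exp_ofReal_mul_I_im]
    have hπ := Real.pi_pos
    rcases hφ.2.lt_or_eq with h1 | rfl
    · exact .inl (mul_pos hm (Real.sin_pos_of_pos_of_lt_pi (mul_pos hπ hφ.1) (by nlinarith)))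
    · right
      simpa using hm
  | ext T hT _ _ h₁ h₃ =>
    rw [K0.cls_of_distTriang hT, map_add]
    rcases h₁ with h₁ | h₁
    · rcases h₃ with h₃ | h₃
      · exact .inl (Triangle.isZero₂_of_isZero₁₃ _ hT h₁ h₃)
      · rw [K0.cls_isZero h₁, map_zero, zero_add]
        exact .inr h₃
    · right
      rcases h₃ with h₃ | h₃
      · rw [K0.cls_isZero h₃, map_zero, add_zero]
        exact h₁
      · rw [Complex.add_im, Complex.add_re]
        rcases h₁ with h₁ | h₁ <;> rcases h₃ with h₃ | h₃
        · exact .inl (by linarith)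
        · exact .inl (by linarith)
        · exact .inl (by linarith)
        · exact .inr ⟨by linarith, by linarith⟩

theorem eventually_rotatedIm_nonneg {z : ℂ} (hz : 0 < z.im ∨ z.im = 0 ∧ z.re < 0) :
    ∀ᶠ t in nhdsWithin (0 : ℝ) (Set.Ioi 0), 0 ≤ rotatedIm (Real.pi * t) z := by
  simp only [rotatedIm_apply]
  rcases hz with hz | ⟨hz, hz'⟩
  · have hc : Continuous fun t : ℝ =>
        z.im * Real.cos (Real.pi * t) - z.re * Real.sin (Real.pi * t) := by fun_prop
    have h0 : 0 < z.im * Real.cos (Real.pi * 0) - z.re * Real.sin (Real.pi * 0) := by simpa using hz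
    filter_upwards [nhdsWithin_le_nhds (hc.continuousAt.eventually (lt_mem_nhds h0))] with t ht
    exact ht.le
  · filter_upwards [Ioo_mem_nhdsGT (zero_lt_one (α := ℝ))] with t ht
    have hs : 0 ≤ Real.sin (Real.pi * t) := Real.sin_nonneg_of_nonneg_of_le_pi
      (mul_nonneg Real.pi_pos.le ht.1.le) (by nlinarith [Real.pi_pos, ht.2])
    rw [hz]
    nlinarith

variable [IsTriangulated C]

/-- A maximal subobject `F` with nonnegative value must be all of `E`: otherwise the preimage of a
simple subobject of `E / F` is larger and still has nonnegative value. -/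
theorem nonneg_of_nonneg_on_simples (hnoeth : ∀ X : σ.Heart, IsNoetherianObject X)
    (hart : ∀ X : σ.Heart, IsArtinianObject X) (L : ℂ →+ ℝ)
    (hL : ∀ S : σ.Heart, Simple S → 0 ≤ L (σ.Z (K0.cls S.obj))) (E : σ.Heart) :
    0 ≤ L (σ.Z (K0.cls E.obj)) := by
  have := hnoeth E
  let s : Set (Subobject E) := {F | 0 ≤ L (σ.Z (K0.cls (F : σ.Heart).obj))}
  have hs : s.Nonempty := by
    refine ⟨⊥, ?_⟩
    have h : IsZero ((⊥ : Subobject E) : σ.Heart) :=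
      (isZero_zero _).of_iso Subobject.botCoeIsoZero
    change 0 ≤ L (σ.Z (K0.cls ((⊥ : Subobject E) : σ.Heart).obj))
    rw [K0.cls_isZero (heart_isZero_iff.1 h), map_zero, map_zero]
  obtain ⟨F, hF, hmax⟩ := WellFounded.has_min (wellFounded_gt (α := Subobject E)) s hs
  by_cases hiso : IsIso F.arrow
  · rw [← heart_cls_iso (asIso F.arrow)]
    exact hF
  exfalso
  obtain ⟨Q, p, h⟩ := SES.of_mono F.arrow
  have hQ : ¬ IsZero Q := fun hQ => hiso (h.isZero_right_iff.1 hQ)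
  have := hart Q
  obtain ⟨S, hS⟩ := exists_simple_subobject hQ
  obtain ⟨Q', q, h'⟩ := SES.of_mono S.arrow
  have := h.epi
  have := h'.epi
  obtain ⟨F', j, hj⟩ := SES.of_epi (p ≫ q)
  have := hj.mono
  have hcls : K0.cls F'.obj = K0.cls (F : σ.Heart).obj + K0.cls (S : σ.Heart).obj := by
    have h₁ := h.cls
    rw [hj.cls, h'.cls, ← add_assoc] at h₁
    exact add_right_cancel h₁
  have hmk : K0.cls ((Subobject.mk j : Subobject E) : σ.Heart).obj = K0.cls F'.obj :=
    heart_cls_iso (Subobject.underlyingIso j)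
  refine hmax (Subobject.mk j) ?_ ?_
  · change 0 ≤ L (σ.Z (K0.cls ((Subobject.mk j : Subobject E) : σ.Heart).obj))
    rw [hmk, hcls, map_add, map_add]
    exact add_nonneg hF (hL _ hS)
  · obtain ⟨k, hk⟩ := hj.exists_lift F.arrow (by rw [← Category.assoc, h.zero, zero_comp])
    refine lt_of_le_of_ne (Subobject.le_mk_of_comm k hk) fun heq => ?_
    rw [← heq, hcls] at hmk
    -- If the enlarged subobject were `F` again, the simple `S` would have zero class, but its
    -- charge is nonzero.
    have h0 : K0.cls (S : σ.Heart).obj = 0 := by simpa using hmk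
    have := charge_mem_upperHalf (S : σ.Heart).property
      (fun h => Simple.not_isZero _ (heart_isZero_iff.2 h))
    rw [h0] at this
    simp at this

theorem exists_gap_of_isAlgebraic (h : IsAlgebraic σ.Heart) :
    ∃ δ : ℝ, 0 < δ ∧ ∀ X : C, σ.interval (Set.Ioo 0 δ) X → IsZero X := by
  have hev : ∀ᶠ t in nhdsWithin (0 : ℝ) (Set.Ioi 0), ∀ S : σ.Heart, Simple S →
      0 ≤ rotatedIm (Real.pi * t) (σ.Z (K0.cls S.obj)) := by
    have := (Filter.eventually_all_finite h.finite_simples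
      (l := nhdsWithin (0 : ℝ) (Set.Ioi 0)) (p := fun s t => ∀ S : σ.Heart, Simple S →
        Quotient.mk _ S = s → 0 ≤ rotatedIm (Real.pi * t) (σ.Z (K0.cls S.obj)))).2 (by
      rintro s ⟨S, hS, rfl⟩
      have hS0 : ¬ IsZero S.obj := fun h => Simple.not_isZero S (heart_isZero_iff.2 h)
      filter_upwards [eventually_rotatedIm_nonneg (charge_mem_upperHalf S.property hS0)]
        with t ht S' _ hSS'
      obtain ⟨e⟩ : Nonempty (S' ≅ S) := Quotient.exact hSS'
      rwa [heart_cls_iso e])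
    filter_upwards [this] with t ht S hS
    exact ht _ ⟨S, hS, rfl⟩ S hS rfl
  obtain ⟨δ, hδ, hsub⟩ := mem_nhdsGT_iff_exists_Ioo_subset.1 hev
  -- Capping at `1` keeps the semistable objects considered inside the heart.
  have hδ0 : 0 < min δ 1 := lt_min hδ one_pos
  refine ⟨min δ 1, hδ0, fun X hX => σ.isZero_of_interval_of_P (fun φ hφ E hE => ?_) hX⟩
  by_contra hE0
  -- Rotating by `πt` with `φ < t < 1` moves phase `φ` to an angle in `(-π, 0)`, where the sine is
  -- negative.
  obtain ⟨t, ht, ht'⟩ := exists_between hφ.2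
  have ht1 : t < 1 := ht'.trans_le (min_le_right _ _)
  have hφ1 : φ < 1 := ht.trans ht1
  have htmem : t ∈ Set.Ioo 0 δ := ⟨hφ.1.trans ht, ht'.trans_le (min_le_left _ _)⟩
  have hnn := nonneg_of_nonneg_on_simples h.noetherian h.artinian (rotatedIm (Real.pi * t))
    (hsub htmem) ⟨E, σ.interval_of_P hE ⟨hφ.1, hφ1.le⟩⟩
  obtain ⟨m, hm, hZ⟩ := σ.charge φ E hE hE0
  change 0 ≤ rotatedIm (Real.pi * t) (σ.Z (K0.cls E)) at hnn
  rw [hZ, rotatedIm_polar] at hnn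
  have hπ := Real.pi_pos
  have hneg : Real.sin (Real.pi * φ - Real.pi * t) < 0 :=
    Real.sin_neg_of_neg_of_neg_pi_lt (by nlinarith) (by nlinarith [hφ.1])
  exact absurd hnn (not_le.2 (mul_neg_of_pos_of_neg hm hneg))

end StabilityCondition

end BridgelandStability

theorem proposition4p1 {C : Type u} [Category.{v} C] [Preadditive C] [HasZeroObject C]
    [HasShift C ℤ] [∀ n : ℤ, (shiftFunctor C n).Additive] [Pretriangulated C] [IsTriangulated C]
    (hK : Module.Finite ℤ
      (BridgelandStability.K0 C ⧸ Submodule.torsion ℤ (BridgelandStability.K0 C)))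
    (N : Seminorm ℝ (ℝ ⊗[ℤ] BridgelandStability.K0 C)) (hN : ∀ x, N x = 0 → x = 0)
    (σ : BridgelandStability.StabilityCondition C) (hσ : σ.SupportProperty N) :
    BridgelandStability.IsAlgebraic σ.Heart ↔
      ∃ δ : ℝ, 0 < δ ∧ ∀ X : C, σ.interval (Set.Ioo 0 δ) X → IsZero X := by
  constructor
  · exact BridgelandStability.StabilityCondition.exists_gap_of_isAlgebraic
  · rintro ⟨δ, hδ, hP⟩
    obtain ⟨size, hs⟩ := σ.exists_size hK N hN hσ hδ hP
    exact
      { abelian := ⟨inferInstance⟩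
        noetherian := hs.isNoetherianObject
        artinian := hs.isArtinianObject
        finite_simples := hs.finite_simples hK }
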